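/- **Setting.** Let $H$ be a class of measurable classifiers $X\to\{0,1\}$ of finite VC-dimension $d$, satisfying the usual measurability condition of being universally separable (some countable $H_0\subseteq H$ has every $h\in H$ as a pointwise limit of a sequence in $H_0$). There are $k$ players; player $i$ has a distribution $D_i$ on $X$ and a noise rate $0\le\eta_i<\frac12$, and draws independent examples $(x,y)$ with $x\sim D_i$, where $y=h^*(x)$ with probability $1-\eta_i$ and $y=\lnot h^*(x)$ with probability $\eta_i$, for a common target $h^*\in H$. Write $\eta_{\max}=\max_i\eta_i$, let $\epsilon,\delta>0$, and put $\delta'=\delta/(2\log_2 k)$. For $\epsilon',\delta''>0$ and $0\le\eta<\frac12$ let $m_{\epsilon',\delta'',\eta}$ be the sample complexity of learning $H$ with classification noise by empirical risk minimization (ERM): the least $m$ such that for every $n\ge m$, every distribution $D$ on $X$, every target in $H$ and every ERM rule for $H$ (a rule returning, on each sample, a member of $H$ with the fewest disagreements), the ERM hypothesis of $n$ independent examples of noise rate $\eta$ has error $\ge\epsilon'$ on the noiseless distribution $D$ with probability at most $\delta''$. **Personalized Learning with Classification Noise.** All players and a center write on a shared blackboard. Start with $N_1=\{1,\dots,k\}$.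 In each round $j=1,\dots,\lceil\log_2 k\rceil$ with $N_j\neq\emptyset$, put $\bar\eta_{N_j}=\frac1{|N_j|}\sum_{i\in N_j}\eta_i$. The center distributes $m_{\epsilon/4,\delta',\bar\eta_{N_j}}$ draws uniformly at random over the players of $N_j$ and writes, for each such player, the number of its draws (in a self-delimiting binary code in which a number with $b$ binary digits takes $2b+1$ bits); the players write that many of their noisy examples; everybody computes an ERM hypothesis $h_j\in H$ of the examples written in this round; each $i\in N_j$ draws $T_i=\left\lceil c\,\frac{\ln(|N_j|/\delta')}{\epsilon(1-2\eta_i)}\right\rceil$ (taken to be $0$ if negative) further examples locally, where $c>0$ is a constant of the algorithm, and writes one bit saying whether the empirical error of $h_j$ on them is at most $\eta_i+\frac{3\epsilon}4(1-2\eta_i)$. The players that pass receive $f_i=h_j$ and are removed from $N_j$ to give $N_{j+1}$. **Proposition.** All the sample complexities $m_{\epsilon',\delta'',\eta}$ above are finite, and Personalized Learning with Classification Noise communicates $$\tilde O\left(\log(k)\,\frac{d}{\epsilon(1-2\eta_{\max})^2}\right)\text{ samples and }\tilde O\left(k\log\left(\frac{d}{\epsilon(1-2\eta_{\max})^2}\right)\right)\text{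 additional bits.}$$ Precisely: there are universal constants $C>0$ and $p\in\mathbb N$ such that for all $X$, $H$, $d$, $k$, $D_i$, $\eta_i$, $h^*$, $\epsilon$, $\delta$, $c$ and every ERM rule as above, in every execution (whatever the outcomes of the random draws), $$\#\text{samples}\le C\,F\,\log(2+F)^p\,\log(2+1/\delta),\qquad \#\text{bits}\le C\,G\,\log(2+G)^p\,\log(2+1/\delta),$$ where $F=\log(k)\,\frac{d}{\epsilon(1-2\eta_{\max})^2}$ and $G=k\log\left(2+\frac{d}{\epsilon(1-2\eta_{\max})^2}\right)$. -/

import Mathlib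

open MeasureTheory ProbabilityTheory Filter

namespace NoisyCollab

/-! ### Hypothesis classes -/

section Classes

variable {X : Type*}

/-- The class `H` of binary classifiers shatters the finite set `s`. -/
def Shatters (H : Set (X → Bool)) (s : Finset X) : Prop :=
  ∀ g : X → Bool, ∃ h ∈ H, ∀ x ∈ s, h x = g x

/-- `H` has (finite) VC-dimension `d`: the largest cardinality of a shattered set is `d`. -/
def HasVCDim (H : Set (X → Bool)) (d : ℕ) : Prop :=
  IsGreatest {n : ℕ | ∃ s : Finset X, s.card = n ∧ Shatters H s} d

/-- The usual measurability requirement on a hypothesis class: all classifiers are measurable, and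
`H` is universally separable, i.e. it has a countable subclass of which every member of `H` is a
pointwise limit. -/
def WellBehaved [MeasurableSpace X] (H : Set (X → Bool)) : Prop :=
  (∀ h ∈ H, Measurable h) ∧
    ∃ H₀ : Set (X → Bool), H₀ ⊆ H ∧ H₀.Countable ∧
      ∀ h ∈ H, ∃ u : ℕ → X → Bool, (∀ n, u n ∈ H₀) ∧ ∀ x, ∀ᶠ n in atTop, u n x = h x

end Classes

/-! ### Classification noise, empirical risk minimization and its sample complexity -/

section Noise

variable {X : Type*}

/-- The noisy example distribution: `x ∼ D`, and the label is `hstar x` with probability `1 - η`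
and the opposite label with probability `η`. -/
noncomputable def noisyEX [MeasurableSpace X] (D : Measure X) (η : ℝ) (hstar : X → Bool) :
    Measure (X × Bool) :=
  ENNReal.ofReal (1 - η) • D.map (fun x => (x, hstar x)) +
    ENNReal.ofReal η • D.map (fun x => (x, !(hstar x)))

/-- The generalization error of `h` on the clean distribution `D` with target `hstar`. -/
noncomputable def cleanErr [MeasurableSpace X] (D : Measure X) (hstar h : X → Bool) : ℝ :=
  D.real {x | h x ≠ hstar x}

/-- The number of examples of the sample `S` that are misclassified by `h`. -/
def disagreements (h : X → Bool) (S : List (X × Bool)) : ℕ :=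
  S.countP (fun z => h z.1 != z.2)

/-- The empirical error of `h` on the sample `S`. -/
noncomputable def empErr (h : X → Bool) (S : List (X × Bool)) : ℝ :=
  (disagreements h S : ℝ) / S.length

/-- `A` is an empirical risk minimizer for `H`: on every sample it returns a member of `H` with the
fewest disagreements. -/
def IsERM (H : Set (X → Bool)) (A : List (X × Bool) → X → Bool) : Prop :=
  ∀ S, A S ∈ H ∧ ∀ h ∈ H, disagreements (A S) S ≤ disagreements h S

/-- With `n` independent noisy examples of noise rate `η`, every empirical risk minimizer has, for
every distribution and every target in `H`, clean error at least `ε` with probability at most `δ`.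
(For a non-measurable event the measure is the outer measure.) -/
def ERMSucceeds [MeasurableSpace X] (H : Set (X → Bool)) (ε δ η : ℝ) (n : ℕ) : Prop :=
  ∀ D : Measure X, IsProbabilityMeasure D → ∀ hstar ∈ H, ∀ A, IsERM H A →
    Measure.pi (fun _ : Fin n => noisyEX D η hstar)
      {S | ε ≤ cleanErr D hstar (A (List.ofFn S))} ≤ ENNReal.ofReal δ

/-- `m` examples or more are always enough. -/
def SufficientSize [MeasurableSpace X] (H : Set (X → Bool)) (ε δ η : ℝ) (m : ℕ) : Prop :=
  ∀ n, m ≤ n → ERMSucceeds H ε δ η n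

/-- The sample complexity of PAC learning `H` with classification noise of rate `η` by empirical
risk minimization: the least sufficient sample size. -/
noncomputable def sampleComplexity [MeasurableSpace X] (H : Set (X → Bool)) (ε δ η : ℝ) : ℕ :=
  sInf {m | SufficientSize H ε δ η m}

end Noise

/-! ### Communication on a shared blackboard -/

/-- What is written on the blackboard: single bits and labelled examples. -/
inductive Symb (X : Type*) where
  | bit (b : Bool) : Symb X
  | example_ (z : X × Bool) : Symb X

namespace Symb

variable {X : Type*}

def isBit : Symb X → Bool
  | bit _ => true
  | example_ _ => false

def isExample : Symb X → Bool
  | bit _ => false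
  | example_ _ => true

end Symb

/-- A self-delimiting binary code for natural numbers: every binary digit is preceded by the flag
`true`, and the flag `false` ends the word. -/
def encodeNat (n : ℕ) : List Bool :=
  n.bits.flatMap (fun b => [true, b]) ++ [false]

/-! ### The algorithm -/

section Algorithm

variable {X : Type*} {k : ℕ}

/-- The average noise rate of the players in `N`. -/
noncomputable def avgNoise (η : Fin k → ℝ) (N : Finset (Fin k)) : ℝ :=
  (∑ i ∈ N, η i) / N.card

/-- The maximal noise rate of the players. -/
noncomputable def maxNoise (η : Fin k → ℝ) : ℝ := ⨆ i, η i

/-- The confidence parameter `δ' = δ / (2 log k)` used in each round. -/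
noncomputable def roundConf (k : ℕ) (δ : ℝ) : ℝ := δ / (2 * Real.logb 2 k)

/-- The outcomes of all random draws.
`pick j t N _` is the player chosen from the set `N` for the `t`-th example of round `j`,
`train j t i` is the `t`-th training example of player `i` in round `j`, and
`test j i t` is the `t`-th test example of player `i` in round `j`. -/
structure Draws (X : Type*) (k : ℕ) where
  pick : ℕ → ℕ → (N : Finset (Fin k)) → N.Nonempty → N
  train : ℕ → ℕ → Fin k → X × Bool
  test : ℕ → Fin k → ℕ → X × Bool

/-- Names of the individual draws. -/
inductive DrawName (k : ℕ) where
  | pick (j t : ℕ) (N : Finset (Fin k)) (hN : N.Nonempty) : DrawName k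
  | train (j t : ℕ) (i : Fin k) : DrawName k
  | test (j : ℕ) (i : Fin k) (t : ℕ) : DrawName k

/-- The σ-algebra generated by one draw. -/
@[reducible]
def drawSigma [MeasurableSpace X] {Ω : Type*} (R : Ω → Draws X k) :
    DrawName k → MeasurableSpace Ω
  | .pick j t N hN => MeasurableSpace.comap (fun ω => (R ω).pick j t N hN) ⊤
  | .train j t i => MeasurableSpace.comap (fun ω => (R ω).train j t i) inferInstance
  | .test j i t => MeasurableSpace.comap (fun ω => (R ω).test j i t) inferInstance

/-- The random draws `R` have the right joint law: players are picked uniformly from the current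
set, all examples of player `i` come from the noisy distribution of player `i`, and all draws are
independent. -/
structure IsRandomDraws [MeasurableSpace X] {Ω : Type*} [MeasurableSpace Ω] (P : Measure Ω)
    (D : Fin k → Measure X) (η : Fin k → ℝ) (hstar : X → Bool) (R : Ω → Draws X k) : Prop where
  meas : ∀ a, drawSigma R a ≤ (inferInstance : MeasurableSpace Ω)
  pick_law : ∀ (j t : ℕ) (N : Finset (Fin k)) (hN : N.Nonempty) (i : N),
    P {ω | (R ω).pick j t N hN = i} = (N.card : ENNReal)⁻¹
  train_law : ∀ j t i, P.map (fun ω => (R ω).train j t i) = noisyEX (D i) (η i) hstar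
  test_law : ∀ j i t, P.map (fun ω => (R ω).test j i t) = noisyEX (D i) (η i) hstar
  indep : iIndep (drawSigma R) P

/-- The state of the algorithm: the players still active, the classifiers handed out so far, and
the contents of the blackboard. -/
structure State (X : Type*) (k : ℕ) where
  active : Finset (Fin k)
  out : Fin k → Option (X → Bool)
  board : List (Symb X)

/-- The players of `N` in increasing order. -/
def members (N : Finset (Fin k)) : List (Fin k) := (List.finRange k).filter (fun i => i ∈ N)

/-- The positions of a sample of size `m` from the mixture over `N` that fall to player `i`. -/
def slots (ω : Draws X k) (j m : ℕ) (N : Finset (Fin k)) (hN : N.Nonempty) (i : Fin k) : List ℕ :=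
  (List.range m).filter (fun t => ((ω.pick j t N hN : N) : Fin k) = i)

/-- The number of test examples drawn by a player of noise rate `ηi` out of `n` active players. -/
noncomputable def testSize (c ε δ' ηi : ℝ) (n : ℕ) : ℕ :=
  ⌈c * Real.log (n / δ') / (ε * (1 - 2 * ηi))⌉₊

open Classical in
/-- The players of `N` whose noise-adjusted test the classifier `h` passes in round `j`. -/
noncomputable def cnTest (c ε δ' : ℝ) (η : Fin k → ℝ) (ω : Draws X k) (j : ℕ) (h : X → Bool)
    (N : Finset (Fin k)) : Finset (Fin k) :=
  N.filter fun i =>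
    empErr h ((List.range (testSize c ε δ' (η i) N.card)).map (ω.test j i)) ≤
      η i + 3 * ε / 4 * (1 - 2 * η i)

/-- One round. The center draws a multinomial sample of the given size over the active players and
sends to each of them the number of examples that it has to contribute; the players write these
examples on the blackboard; everybody computes the empirical risk minimizer of the examples written
in this round; each active player tests it locally and writes one bit. -/
noncomputable def round [MeasurableSpace X] (H : Set (X → Bool)) (c ε δ : ℝ) (η : Fin k → ℝ)
    (A : List (X × Bool) → X → Bool) (ω : Draws X k) (j : ℕ) (s : State X k) : State X k :=
  open Classical in
  if hN : s.active.Nonempty then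
    let N := s.active
    let δ' := roundConf k δ
    let m := sampleComplexity H (ε / 4) δ' (avgNoise η N)
    let requests : List Bool :=
      (members N).flatMap fun i => encodeNat (slots ω j m N hN i).length
    let S : List (X × Bool) :=
      (members N).flatMap fun i => (slots ω j m N hN i).map fun t => ω.train j t i
    let h := A S
    let G := cnTest c ε δ' η ω j h N
    let verdicts : List Bool := (members N).map fun i => decide (i ∈ G)
    { active := N \ G
      out := fun i => if i ∈ G then some h else s.out i
      board := s.board ++ requests.map Symb.bit ++ S.map Symb.example_ ++ verdicts.map Symb.bit }
  else s

/-- The state after `n` rounds. -/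
noncomputable def stateAfter [MeasurableSpace X] (H : Set (X → Bool)) (c ε δ : ℝ) (η : Fin k → ℝ)
    (A : List (X × Bool) → X → Bool) (ω : Draws X k) : ℕ → State X k
  | 0 => { active := Finset.univ, out := fun _ => none, board := [] }
  | n + 1 => round H c ε δ η A ω (n + 1) (stateAfter H c ε δ η A ω n)

/-- The final state of Personalized Learning with Classification Noise, after `⌈log k⌉` rounds. -/
noncomputable def finalState [MeasurableSpace X] (H : Set (X → Bool)) (c ε δ : ℝ) (η : Fin k → ℝ)
    (A : List (X × Bool) → X → Bool) (ω : Draws X k) : State X k :=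
  stateAfter H c ε δ η A ω (Nat.clog 2 k)

/-- The number of examples communicated in an execution. -/
noncomputable def samplesCommunicated [MeasurableSpace X] (H : Set (X → Bool)) (c ε δ : ℝ)
    (η : Fin k → ℝ) (A : List (X × Bool) → X → Bool) (ω : Draws X k) : ℕ :=
  (finalState H c ε δ η A ω).board.countP Symb.isExample

/-- The number of bits communicated in an execution, besides the examples. -/
noncomputable def bitsCommunicated [MeasurableSpace X] (H : Set (X → Bool)) (c ε δ : ℝ)
    (η : Fin k → ℝ) (A : List (X × Bool) → X → Bool) (ω : Draws X k) : ℕ :=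
  (finalState H c ε δ η A ω).board.countP Symb.isBit

end Algorithm

/-- The expression hidden in soft-O notation: `C · F` up to a power of `log F`, with the suppressed
dependence on the confidence parameter being a factor `log (1 / δ)`. -/
noncomputable def softBound (C : ℝ) (p : ℕ) (δ F : ℝ) : ℝ :=
  C * F * Real.log (2 + F) ^ p * Real.log (2 + 1 / δ)

end NoisyCollab

open NoisyCollab

/-! The communication bounds are deterministic. A round with sample size `m` writes at most `m`
examples and, per active player, one code word for a number at most `m` plus a verdict bit. There
are at most `4 log k` rounds, so everything reduces to bounding the ERM sample complexity at each
average noise rate. An average is at most the maximum, so `β = 1 - 2 * maxNoise η` serves every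
round.

The required rate `d / (ε β²)`, up to logarithms, is linear in `1 / ε`, so two-sided uniform
convergence of empirical errors would be too weak. The argument has two stages. On the unlabelled
points, symmetrization with a ghost sample shows that, with high probability, every classifier of
error at least `ε` differs from the target at `n ε / 16` or more points
(`measure_exists_card_diffSet_le`). With the points fixed, the label flips are independent coins. A
classifier fits at least as well as the target only if at least half of the labels on their
disagreement set are flipped, which a Chernoff bound makes exponentially unlikely in `β²` times its
size (`measure_flips_le`). Sauer–Shelah leaves polynomially many disagreement sets for the union
bounds (`card_patterns_le`), and universal separability reduces `H` to a countable class.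

Solving the tail bound for `n` gives `sampleComplexity_round_le`; the remaining work is absorbing
constants and logarithms into the soft-O form. -/

namespace NoisyCollab

/-! ### Sauer–Shelah for symmetric differences with a fixed classifier -/

section Patterns

variable {X : Type*} {ι : Type*} [Fintype ι]

/-- The indices of the points of `x` at which `h` and `g` disagree. -/
def diffSet (g h : X → Bool) (x : ι → X) : Finset ι :=
  Finset.univ.filter fun i => h (x i) ≠ g (x i)

@[simp]
lemma mem_diffSet {g h : X → Bool} {x : ι → X} {i : ι} :
    i ∈ diffSet g h x ↔ h (x i) ≠ g (x i) := by
  simp [diffSet]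

open Classical in
/-- The sets of indices cut out of the points `x` by the symmetric differences with `g`. -/
noncomputable def patterns (H : Set (X → Bool)) (g : X → Bool) (x : ι → X) : Finset (Finset ι) :=
  Finset.univ.filter fun I => ∃ h ∈ H, diffSet g h x = I

lemma mem_patterns {H : Set (X → Bool)} {g : X → Bool} {x : ι → X} {I : Finset ι} :
    I ∈ patterns H g x ↔ ∃ h ∈ H, diffSet g h x = I := by
  simp [patterns]

/-- Termwise comparison with the binomial expansion of `(n + 1) ^ d`, using `n.choose k ≤ n ^ k` and
`1 ≤ d.choose k`. -/
lemma sum_choose_le_pow (n d : ℕ) : ∑ k ∈ Finset.Iic d, n.choose k ≤ (n + 1) ^ d := by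
  rw [add_pow, show Finset.Iic d = Finset.range (d + 1) by ext; simp]
  refine Finset.sum_le_sum fun k hk => ?_
  have hk : k ≤ d := by simpa [Nat.lt_succ_iff] using hk
  simp only [one_pow, mul_one]
  exact (Nat.choose_le_pow n k).trans (Nat.le_mul_of_pos_right _ (Nat.choose_pos hk))

/-- Taking symmetric differences with `g` does not change which point sets are shattered, so the
family of index sets has VC dimension at most `d` and Sauer–Shelah applies. -/
lemma card_patterns_le {H : Set (X → Bool)} {d : ℕ} (hd : HasVCDim H d) (g : X → Bool)
    (x : ι → X) : (patterns H g x).card ≤ (Fintype.card ι + 1) ^ d := by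
  classical
  have hvc : (patterns H g x).vcDim ≤ d := by
    refine Finset.sup_le fun J hJ => ?_
    rw [Finset.mem_shatterer] at hJ
    -- Indices carrying the same point lie in the same patterns, so a family that cuts out every
    -- singleton of `J` forces distinct points.
    have hinj : Set.InjOn x J := by
      intro i hi j hj hij
      obtain ⟨I, hI, hJI⟩ := hJ (t := {i}) (by simpa using hi)
      obtain ⟨h, -, rfl⟩ := mem_patterns.1 hI
      have h1 : i ∈ J ∩ diffSet g h x := by rw [hJI]; simp
      have h2 : j ∈ J ∩ diffSet g h x := by
        simp only [diffSet, Finset.mem_inter, Finset.mem_filter, Finset.mem_univ, true_and]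
          at h1 ⊢
        exact ⟨hj, by rw [← hij]; exact h1.2⟩
      rw [hJI] at h2
      exact (Finset.mem_singleton.1 h2).symm
    rw [← Finset.card_image_of_injOn hinj]
    refine hd.2 ⟨J.image x, rfl, fun f => ?_⟩
    -- To realize the labelling `f`, cut out the indices where `f` differs from `g`: two Boolean
    -- values that differ from `g` at the same places are equal.
    obtain ⟨I, hI, hJI⟩ := hJ (t := J.filter fun i => f (x i) ≠ g (x i)) (Finset.filter_subset _ _)
    obtain ⟨h, hh, rfl⟩ := mem_patterns.1 hI
    refine ⟨h, hh, fun y hy => ?_⟩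
    obtain ⟨i, hi, rfl⟩ := Finset.mem_image.1 hy
    have := congrArg (fun K => i ∈ K) hJI
    simp only [diffSet, Finset.mem_inter, Finset.mem_filter, Finset.mem_univ, true_and, hi,
      eq_iff_iff] at this
    revert this
    cases h (x i) <;> cases f (x i) <;> cases g (x i) <;> simp
  calc (patterns H g x).card ≤ (patterns H g x).shatterer.card := Finset.card_le_card_shatterer _
    _ ≤ ∑ k ∈ Finset.Iic (patterns H g x).vcDim, (Fintype.card ι).choose k :=
        Finset.card_shatterer_le_sum_vcDim
    _ ≤ ∑ k ∈ Finset.Iic d, (Fintype.card ι).choose k :=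
        Finset.sum_le_sum_of_subset (Finset.Iic_subset_Iic.2 hvc)
    _ ≤ _ := sum_choose_le_pow _ _

lemma measurable_card_diffSet [MeasurableSpace X] {g h : X → Bool} (hg : Measurable g)
    (hh : Measurable h) : Measurable fun x : ι → X => ((diffSet g h x).card : ℝ) := by
  have : ∀ x : ι → X, ((diffSet g h x).card : ℝ) = ∑ i, if h (x i) ≠ g (x i) then 1 else 0 := by
    intro x
    rw [diffSet, Finset.card_filter]
    push_cast
    rfl
  simp_rw [this]
  refine Finset.measurable_sum _ fun i _ => Measurable.ite ?_ measurable_const measurable_const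
  exact (measurableSet_eq_fun (hh.comp (measurable_pi_apply i))
    (hg.comp (measurable_pi_apply i))).compl

end Patterns

/-! ### Exponential Markov inequality and Bernoulli label noise -/

section Chernoff

/-- Markov's inequality for a product of independent nonnegative functions. -/
lemma measure_pi_le_prod {ι : Type*} [Fintype ι] {α : Type*} [MeasurableSpace α] (μ : Measure α)
    [IsProbabilityMeasure μ] (f : ι → α → ℝ) (hf0 : ∀ i a, 0 ≤ f i a)
    (hf : ∀ i, Measurable (f i)) (r : ι → ℝ)
    (hr : ∀ i, ∫⁻ a, ENNReal.ofReal (f i a) ∂μ ≤ ENNReal.ofReal (r i)) (hr0 : ∀ i, 0 ≤ r i)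
    {c : ℝ} (hc : 0 < c) (E : Set (ι → α)) (hE : ∀ a ∈ E, c ≤ ∏ i, f i (a i)) :
    Measure.pi (fun _ : ι => μ) E ≤ ENNReal.ofReal ((∏ i, r i) / c) := by
  have hmeas : ∀ i, Measurable fun a => ENNReal.ofReal (f i a) := fun i => (hf i).ennreal_ofReal
  have hind := iIndepFun_pi (μ := fun _ : ι => μ) (X := fun i a => ENNReal.ofReal (f i a))
    (fun i => (hmeas i).aemeasurable)
  have hprod := lintegral_prod_eq_prod_lintegral_of_indepFun Finset.univ _ hind
    (fun i => (hmeas i).comp (measurable_pi_apply i))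
  have hcoord : ∀ i, ∫⁻ a : ι → α, ENNReal.ofReal (f i (a i)) ∂Measure.pi (fun _ : ι => μ) =
      ∫⁻ a, ENNReal.ofReal (f i a) ∂μ := fun i =>
    (measurePreserving_eval (fun _ : ι => μ) i).lintegral_comp (hmeas i)
  have hsub : E ⊆ {a | ENNReal.ofReal c ≤ ∏ i, ENNReal.ofReal (f i (a i))} := by
    intro a ha
    rw [Set.mem_ofPred_eq, ← ENNReal.ofReal_prod_of_nonneg fun i _ => hf0 i _]
    exact ENNReal.ofReal_le_ofReal (hE a ha)
  refine (measure_mono hsub).trans ((meas_ge_le_lintegral_div ?_ ?_ ?_).trans ?_)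
  · exact (Finset.measurable_prod _ fun i _ => (hmeas i).comp (measurable_pi_apply i)).aemeasurable
  · simpa using hc
  · simp
  · rw [hprod, ENNReal.ofReal_div_of_pos hc, ENNReal.ofReal_prod_of_nonneg fun i _ => hr0 i]
    gcongr with i
    rw [hcoord]
    exact hr i

/-- The Bernoulli distribution with parameter `η`. -/
noncomputable def bern (η : ℝ) : Measure Bool :=
  ENNReal.ofReal (1 - η) • Measure.dirac false + ENNReal.ofReal η • Measure.dirac true

lemma isProbabilityMeasure_bern {η : ℝ} (h0 : 0 ≤ η) (h1 : η ≤ 1) :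
    IsProbabilityMeasure (bern η) := by
  constructor
  simp only [bern, Measure.coe_add, Measure.coe_smul, Pi.add_apply, Pi.smul_apply, measure_univ,
    smul_eq_mul, mul_one]
  rw [← ENNReal.ofReal_add (by linarith) h0]
  simp

lemma lintegral_bern {η : ℝ} (h0 : 0 ≤ η) (h1 : η ≤ 1) {f : Bool → ℝ} (hf : ∀ b, 0 ≤ f b) :
    ∫⁻ b, ENNReal.ofReal (f b) ∂bern η = ENNReal.ofReal ((1 - η) * f false + η * f true) := by
  rw [bern, lintegral_add_measure, lintegral_smul_measure, lintegral_smul_measure,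
    lintegral_dirac, lintegral_dirac, ENNReal.ofReal_add (mul_nonneg (by linarith) (hf _))
    (mul_nonneg h0 (hf _)), ENNReal.ofReal_mul (by linarith), ENNReal.ofReal_mul h0]
  rfl

instance isProbabilityMeasure_bern_half : IsProbabilityMeasure (bern (1 / 2)) :=
  isProbabilityMeasure_bern (by norm_num) (by norm_num)

/-- Separates the noise from the point: the label is the true one xor an independent coin, which
later allows conditioning on the points. -/
lemma noisyEX_eq_map {X : Type*} [MeasurableSpace X] (D : Measure X) [SFinite D] (η : ℝ)
    {g : X → Bool} (hg : Measurable g) :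
    noisyEX D η g = (D.prod (bern η)).map fun p => (p.1, xor (g p.1) p.2) := by
  have hm : Measurable fun p : X × Bool => (p.1, xor (g p.1) p.2) := by
    refine measurable_fst.prodMk ?_
    exact (measurable_of_countable fun q : Bool × Bool => xor q.1 q.2).comp
      ((hg.comp measurable_fst).prodMk measurable_snd)
  rw [bern, Measure.prod_add, Measure.prod_smul_right, Measure.prod_smul_right,
    Measure.prod_dirac, Measure.prod_dirac, Measure.map_add _ _ hm, Measure.map_smul,
    Measure.map_smul, Measure.map_map hm measurable_prodMk_right,
    Measure.map_map hm measurable_prodMk_right]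
  simp [noisyEX, Function.comp_def]

end Chernoff

/-! ### Ghost samples and random swaps -/

section Symmetrization

variable {X : Type*} {ι : Type*} [Fintype ι]

lemma prod_diffSet (g h : X → Bool) (x : ι → X) (u : ℝ) :
    ∏ i, (if h (x i) ≠ g (x i) then u else 1) = u ^ (diffSet g h x).card := by
  rw [diffSet, ← Finset.prod_filter, Finset.prod_const]

/-- With probability at least one half, a sample of size `n` hits a set of probability `p` at least
`n p / 4` times. -/
lemma measure_card_diffSet_lt_le [MeasurableSpace X] (D : Measure X) [IsProbabilityMeasure D]
    {g h : X → Bool} (hg : Measurable g) (hh : Measurable h)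
    (hn : 3 ≤ Fintype.card ι * cleanErr D g h) :
    Measure.pi (fun _ : ι => D)
      {x | ((diffSet g h x).card : ℝ) < Fintype.card ι * cleanErr D g h / 4} ≤ 1 / 2 := by
  set p := cleanErr D g h with hp
  have hS : MeasurableSet {x | h x ≠ g x} := (measurableSet_eq_fun hh hg).compl
  -- Each hit contributes a factor 1/2, of mean `1 - p / 2 ≤ exp (-p / 2)`.
  have hint : ∫⁻ a, ENNReal.ofReal (if h a ≠ g a then 1 / 2 else 1) ∂D ≤
      ENNReal.ofReal (Real.exp (-(p / 2))) := by
    have hfun : (fun a => if h a ≠ g a then (1 / 2 : ℝ) else 1) =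
        fun a => 1 - {x | h x ≠ g x}.indicator (fun _ => (1 / 2 : ℝ)) a := by
      funext a
      by_cases ha : h a = g a <;> norm_num [ha]
    have hi : Integrable ({x | h x ≠ g x}.indicator fun _ => (1 / 2 : ℝ)) D :=
      (integrable_const _).indicator hS
    rw [← ofReal_integral_eq_lintegral_ofReal]
    · rw [hfun, integral_sub (integrable_const _) hi, integral_indicator_const _ hS]
      refine ENNReal.ofReal_le_ofReal ?_
      have := Real.add_one_le_exp (-(p / 2))
      simp only [integral_const, probReal_univ, smul_eq_mul]
      rw [hp, cleanErr] at this ⊢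
      linarith
    · rw [hfun]
      exact (integrable_const _).sub hi
    · exact Eventually.of_forall fun a => by dsimp only; split_ifs <;> norm_num
  have hlog := Real.log_two_lt_d9
  -- Since `log 2 / 4 < 7 / 40`, fewer than `n p / 4` hits make the product at least `exp (-7 n p /
  -- 40)`. The resulting bound `exp (-13 n p / 40)` is below 1/2 once `n p ≥ 3`.
  refine (measure_pi_le_prod D (fun _ a => if h a ≠ g a then 1 / 2 else 1) ?_ ?_
    (fun _ => Real.exp (-(p / 2))) (fun _ => hint) (fun _ => (Real.exp_pos _).le)
    (Real.exp_pos (-(Fintype.card ι * p * (7 / 40)))) _ ?_).trans ?_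
  · intro _ a
    split_ifs <;> norm_num
  · exact fun _ => Measurable.ite hS measurable_const measurable_const
  · intro x hx
    rw [prod_diffSet, ← Real.exp_log (show (0 : ℝ) < 1 / 2 by norm_num), ← Real.exp_nat_mul,
      one_div, Real.log_inv]
    refine Real.exp_le_exp.2 ?_
    have hx : ((diffSet g h x).card : ℝ) < Fintype.card ι * p / 4 := hx
    nlinarith [Nat.cast_nonneg (α := ℝ) (diffSet g h x).card]
  · rw [Finset.prod_const, Finset.card_univ, ← Real.exp_nat_mul, ← Real.exp_sub]
    rw [show (1 / 2 : ENNReal) = ENNReal.ofReal (1 / 2) by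
      rw [ENNReal.ofReal_div_of_pos two_pos]
      simp]
    refine ENNReal.ofReal_le_ofReal ?_
    rw [← Real.exp_log (show (0 : ℝ) < 1 / 2 by norm_num), one_div, Real.log_inv]
    refine Real.exp_le_exp.2 ?_
    nlinarith

/-- Under uniformly random swaps within pairs, it is unlikely that the set `I` has few elements
among the first and many among the second components. -/
lemma measure_coin_le [DecidableEq ι] (I : Finset (ι × Bool)) (t : ℝ) :
    Measure.pi (fun _ : ι => bern (1 / 2))
      {s | ((Finset.univ.filter fun i => (i, s i) ∈ I).card : ℝ) ≤ t ∧
        4 * t ≤ (Finset.univ.filter fun i => (i, !(s i)) ∈ I).card} ≤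
      ENNReal.ofReal (Real.exp (-(t / 2))) := by
  -- Weight 1/2 for a first component in `I` and 3/2 for a second one. The mean per pair is 3/4 if
  -- both lie in `I` and 1 otherwise, while on the event the product is at least `(1/2) ^ t * (3/2)
  -- ^ (4 t) ≥ exp (t / 2)`.
  let f : ι → Bool → ℝ := fun i b =>
    (if (i, b) ∈ I then 1 / 2 else 1) * (if (i, !b) ∈ I then 3 / 2 else 1)
  have hf0 : ∀ i b, 0 ≤ f i b := fun i b => by
    dsimp only [f]
    split_ifs <;> norm_num
  refine (measure_pi_le_prod (bern (1 / 2)) f hf0 (fun _ => measurable_of_countable _)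
    (fun _ => 1) (fun i => ?_) (fun _ => zero_le_one) (Real.exp_pos (t / 2)) _ ?_).trans ?_
  · rw [lintegral_bern (by norm_num) (by norm_num) (hf0 i)]
    refine ENNReal.ofReal_le_ofReal ?_
    simp only [f, Bool.not_false, Bool.not_true]
    split_ifs <;> norm_num
  · rintro s ⟨h1, h2⟩
    simp only [f, Finset.prod_mul_distrib]
    rw [← Finset.prod_filter, ← Finset.prod_filter, Finset.prod_const, Finset.prod_const,
      ← Real.exp_log (show (0 : ℝ) < 1 / 2 by norm_num),
      ← Real.exp_log (show (0 : ℝ) < 3 / 2 by norm_num), ← Real.exp_nat_mul, ← Real.exp_nat_mul,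
      ← Real.exp_add, one_div, Real.log_inv]
    refine Real.exp_le_exp.2 ?_
    have hlog := Real.log_two_lt_d9
    have hlog0 := Real.log_two_gt_d9
    have hlog' := Real.one_sub_inv_le_log_of_pos (show (0 : ℝ) < 3 / 2 by norm_num)
    norm_num at hlog'
    nlinarith
  · rw [Finset.prod_const_one, one_div, Real.exp_neg]

variable [MeasurableSpace X]

/-- A sample of pairs with the pairs marked by `s` swapped, as a pair of samples. -/
def swapPairs (z : ι → X × X) (s : ι → Bool) : (ι → X) × (ι → X) :=
  (fun i => _root_.cond (s i) (z i).2 (z i).1, fun i => _root_.cond (s i) (z i).1 (z i).2)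

/-- The two members of a pair are independent with the same law, so any fixed choice of swaps leaves
the double sample's law unchanged. -/
lemma measurePreserving_swapPairs (D : Measure X) [IsProbabilityMeasure D] (s : ι → Bool) :
    MeasurePreserving (fun z => swapPairs z s) (Measure.pi fun _ : ι => D.prod D)
      ((Measure.pi fun _ : ι => D).prod (Measure.pi fun _ : ι => D)) := by
  have h1 : MeasurePreserving (fun (z : ι → X × X) i => _root_.cond (s i) (z i).swap (z i))
      (Measure.pi fun _ : ι => D.prod D) (Measure.pi fun _ : ι => D.prod D) := by
    refine measurePreserving_pi (fun _ => D.prod D) (fun _ => D.prod D)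
      (f := fun i w => _root_.cond (s i) w.swap w) fun i => ?_
    cases s i
    · exact MeasurePreserving.id _
    · exact Measure.measurePreserving_swap
  have h2 := (measurePreserving_arrowProdEquivProdArrow X X ι (fun _ => D) (fun _ => D)).comp h1
  convert h2 using 1
  funext z
  refine Prod.ext (funext fun i => ?_) (funext fun i => ?_)
  · change _root_.cond (s i) (z i).2 (z i).1 = (_root_.cond (s i) (z i).swap (z i)).1
    cases s i <;> rfl
  · change _root_.cond (s i) (z i).1 (z i).2 = (_root_.cond (s i) (z i).swap (z i)).2
    cases s i <;> rfl

lemma measurable_swapPairs :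
    Measurable fun q : (ι → X × X) × (ι → Bool) => swapPairs q.1 q.2 := by
  refine measurable_from_prod_countable_left fun s => ?_
  refine Measurable.prodMk (measurable_pi_lambda _ fun i => ?_) (measurable_pi_lambda _ fun i => ?_)
  · cases hs : s i <;> simp only [hs, cond_false, cond_true]
    exacts [measurable_fst.comp (measurable_pi_apply i), measurable_snd.comp (measurable_pi_apply i)]
  · cases hs : s i <;> simp only [hs, cond_false, cond_true]
    exacts [measurable_snd.comp (measurable_pi_apply i), measurable_fst.comp (measurable_pi_apply i)]

lemma measurableSet_double_sample {g : X → Bool} (hg : Measurable g) {K : Set (X → Bool)}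
    (hK : K.Countable) (hKm : ∀ h ∈ K, Measurable h) (t : ℝ) :
    MeasurableSet {q : (ι → X) × (ι → X) |
      ∃ h ∈ K, ((diffSet g h q.1).card : ℝ) ≤ t ∧ 4 * t ≤ (diffSet g h q.2).card} := by
  have : {q : (ι → X) × (ι → X) |
      ∃ h ∈ K, ((diffSet g h q.1).card : ℝ) ≤ t ∧ 4 * t ≤ (diffSet g h q.2).card} =
      ⋃ h ∈ K, {q | ((diffSet g h q.1).card : ℝ) ≤ t ∧ 4 * t ≤ (diffSet g h q.2).card} := by
    ext q
    simp only [Set.mem_iUnion, Set.mem_ofPred_eq, exists_prop]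
  rw [this]
  refine MeasurableSet.biUnion hK fun h hh => MeasurableSet.inter ?_ ?_
  · exact measurableSet_le ((measurable_card_diffSet hg (hKm h hh)).comp measurable_fst)
      measurable_const
  · exact measurableSet_le measurable_const
      ((measurable_card_diffSet hg (hKm h hh)).comp measurable_snd)

/-- Randomizing the swaps does not change the probability. Once the pairs are fixed only the coins
are random, and a union bound over the patterns on the `2n` points applies `measure_coin_le` to
each. -/
lemma measure_double_sample_le {H : Set (X → Bool)} {d : ℕ} (hd : HasVCDim H d)
    (D : Measure X) [IsProbabilityMeasure D] {g : X → Bool} (hg : Measurable g)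
    {K : Set (X → Bool)} (hKH : K ⊆ H) (hK : K.Countable) (hKm : ∀ h ∈ K, Measurable h)
    (t : ℝ) :
    ((Measure.pi fun _ : ι => D).prod (Measure.pi fun _ : ι => D))
      {q | ∃ h ∈ K, ((diffSet g h q.1).card : ℝ) ≤ t ∧ 4 * t ≤ (diffSet g h q.2).card} ≤
      ENNReal.ofReal ((2 * Fintype.card ι + 1) ^ d * Real.exp (-(t / 2))) := by
  classical
  set F : Set ((ι → X) × (ι → X)) :=
    {q | ∃ h ∈ K, ((diffSet g h q.1).card : ℝ) ≤ t ∧ 4 * t ≤ (diffSet g h q.2).card}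
  have hFm : MeasurableSet F := measurableSet_double_sample hg hK hKm t
  set μ := Measure.pi fun _ : ι => D.prod D
  set ν := Measure.pi fun _ : ι => bern (1 / 2)
  set G : Set ((ι → X × X) × (ι → Bool)) := (fun q => swapPairs q.1 q.2) ⁻¹' F
  have hGm : MeasurableSet G := measurable_swapPairs hFm
  have h1 : (μ.prod ν) G = ((Measure.pi fun _ : ι => D).prod (Measure.pi fun _ : ι => D)) F := by
    rw [Measure.prod_apply_symm hGm]
    have : ∀ s, μ ((fun z => (z, s)) ⁻¹' G) =
        ((Measure.pi fun _ : ι => D).prod (Measure.pi fun _ : ι => D)) F := fun s =>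
      (measurePreserving_swapPairs D s).measure_preimage hFm.nullMeasurableSet
    simp [this]
  rw [← h1, Measure.prod_apply hGm]
  refine (lintegral_mono (g := fun _ =>
    ENNReal.ofReal ((2 * Fintype.card ι + 1) ^ d * Real.exp (-(t / 2)))) fun z => ?_).trans
    (by simp)
  -- All `2n` points in one family: after swapping, the first sample consists of the points `(i, s
  -- i)` and the second of the points `(i, !s i)`.
  let pt : ι × Bool → X := fun q => _root_.cond q.2 (z q.1).2 (z q.1).1
  have hsub : Prod.mk z ⁻¹' G ⊆ ⋃ I ∈ patterns H g pt,
      {s | ((Finset.univ.filter fun i => (i, s i) ∈ I).card : ℝ) ≤ t ∧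
        4 * t ≤ (Finset.univ.filter fun i => (i, !(s i)) ∈ I).card} := by
    rintro s ⟨h, hh, h1, h2⟩
    refine Set.mem_biUnion (x := diffSet g h pt) (mem_patterns.2 ⟨h, hKH hh, rfl⟩) ⟨?_, ?_⟩
    · convert h1 using 3
      ext i
      rw [Finset.mem_filter, mem_diffSet, mem_diffSet]
      exact and_iff_right (Finset.mem_univ i)
    · convert h2 using 3
      ext i
      rw [Finset.mem_filter, mem_diffSet, mem_diffSet, and_iff_right (Finset.mem_univ i)]
      dsimp only [pt, swapPairs]
      cases s i <;> rfl
  refine (measure_mono hsub).trans ((measure_biUnion_finset_le _ _).trans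
    ((Finset.sum_le_sum fun I _ => measure_coin_le I t).trans ?_))
  rw [Finset.sum_const, nsmul_eq_mul, ENNReal.ofReal_mul (by positivity)]
  refine mul_le_mul_left ?_ _
  rw [← ENNReal.ofReal_natCast]
  refine ENNReal.ofReal_le_ofReal ?_
  have := card_patterns_le hd g pt
  rw [Fintype.card_prod, Fintype.card_bool, mul_comm] at this
  exact_mod_cast this

/-- Uniformly over the classifiers of error at least `ε`, the empirical count of errors is at least
a constant fraction of its mean. -/
lemma measure_exists_card_diffSet_le {H : Set (X → Bool)} {d : ℕ} (hd : HasVCDim H d)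
    (D : Measure X) [IsProbabilityMeasure D] {g : X → Bool} (hg : Measurable g)
    {K : Set (X → Bool)} (hKH : K ⊆ H) (hK : K.Countable) (hKm : ∀ h ∈ K, Measurable h)
    {t : ℝ} (hKt : ∀ h ∈ K, 16 * t ≤ Fintype.card ι * cleanErr D g h)
    (hK3 : ∀ h ∈ K, 3 ≤ Fintype.card ι * cleanErr D g h) :
    (Measure.pi fun _ : ι => D) {x | ∃ h ∈ K, ((diffSet g h x).card : ℝ) ≤ t} ≤
      ENNReal.ofReal (2 * ((2 * Fintype.card ι + 1) ^ d * Real.exp (-(t / 2)))) := by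
  set μ := Measure.pi fun _ : ι => D
  have hdouble := measure_double_sample_le (ι := ι) hd D hg hKH hK hKm t
  set F : Set ((ι → X) × (ι → X)) :=
    {q | ∃ h ∈ K, ((diffSet g h q.1).card : ℝ) ≤ t ∧ 4 * t ≤ (diffSet g h q.2).card}
  set E : Set (ι → X) := {x | ∃ h ∈ K, ((diffSet g h x).card : ℝ) ≤ t}
  -- A classifier with too few errors on the first sample has, with probability at least 1/2, at
  -- least a quarter of its mean on the ghost sample; `16 t ≤ n * error` makes that at least `4 t`.
  have hhalf : ∀ x ∈ E, 1 / 2 ≤ μ (Prod.mk x ⁻¹' F) := by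
    rintro x ⟨h, hh, hx⟩
    have hlt := measure_card_diffSet_lt_le (ι := ι) D hg (hKm h hh) (hK3 h hh)
    have hm : MeasurableSet
        {x : ι → X | ((diffSet g h x).card : ℝ) < Fintype.card ι * cleanErr D g h / 4} :=
      measurableSet_lt (measurable_card_diffSet hg (hKm h hh)) measurable_const
    have hc := prob_compl_eq_one_sub (μ := μ) hm
    calc (1 / 2 : ENNReal) = 1 - 1 / 2 := by simp
      _ ≤ _ := tsub_le_tsub_left hlt 1
      _ = _ := hc.symm
      _ ≤ _ := measure_mono fun y hy => by
        have := hKt h hh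
        simp only [Set.mem_compl_iff, Set.mem_ofPred_eq, not_lt] at hy
        exact ⟨h, hh, hx, by linarith⟩
  have hE : 1 / 2 * μ E ≤ (μ.prod μ) F := by
    have hFm : MeasurableSet F := measurableSet_double_sample hg hK hKm t
    rw [Measure.prod_apply hFm]
    refine le_trans ?_ (mul_meas_ge_le_lintegral (measurable_measure_prodMk_left hFm) (1 / 2))
    gcongr
    exact hhalf
  rw [ENNReal.ofReal_mul two_pos.le, ENNReal.ofReal_ofNat]
  calc μ E = 2 * (1 / 2 * μ E) := by
        rw [← mul_assoc, one_div, ENNReal.mul_inv_cancel (by simp) (by simp), one_mul]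
    _ ≤ _ := by gcongr; exact hE.trans hdouble

end Symmetrization

/-! ### Label flips and the tail bound for ERM -/

section Noise

variable {X : Type*} {ι : Type*} [Fintype ι]

/-- It is unlikely that at least half of the labels with index in `I` are flipped. -/
lemma measure_flips_le [DecidableEq ι] (I : Finset ι) {η β : ℝ} (h0 : 0 ≤ η) (hβ : 0 < β)
    (hηβ : β ≤ 1 - 2 * η) :
    Measure.pi (fun _ : ι => bern η)
      {b | (I.filter fun i => b i = false).card ≤ (I.filter fun i => b i = true).card} ≤
      ENNReal.ofReal (Real.exp (-(I.card * β ^ 2 / 2))) := by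
  have h1 : η ≤ 1 := by linarith
  have := isProbabilityMeasure_bern h0 h1
  -- Weight `1 + β` for a flip and its inverse for a non-flip. The mean `(1 - η) / (1 + β) + η (1 +
  -- β)` is at most `1 - β ^ 2 / 2`, with equality when `β = 1 - 2 η`.
  let f : ι → Bool → ℝ := fun i b =>
    if i ∈ I then (if b = true then 1 + β else 1) * (if b = false then (1 + β)⁻¹ else 1) else 1
  have hf0 : ∀ i b, 0 ≤ f i b := fun i b => by
    dsimp only [f]
    split_ifs <;> positivity
  refine (measure_pi_le_prod (bern η) f hf0 (fun _ => measurable_of_countable _)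
    (fun i => if i ∈ I then Real.exp (-(β ^ 2 / 2)) else 1) (fun i => ?_) (fun i => ?_)
    one_pos _ ?_).trans ?_
  · rw [lintegral_bern h0 h1 (hf0 i)]
    refine ENNReal.ofReal_le_ofReal ?_
    by_cases hi : i ∈ I
    · simp only [f, hi, if_true, Bool.false_eq_true, if_false, Bool.true_eq_false, one_mul, mul_one]
      have hexp := Real.add_one_le_exp (-(β ^ 2 / 2))
      refine le_trans ?_ hexp
      rw [← div_eq_mul_inv, div_add' _ _ _ (by positivity), div_le_iff₀ (by positivity)]
      nlinarith
    · simp [f, hi]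
  · split_ifs <;> positivity
  · intro b hb
    have hb : (I.filter fun i => b i = false).card ≤ (I.filter fun i => b i = true).card := hb
    simp only [f]
    rw [← Finset.prod_filter, Finset.filter_mem_eq_inter, Finset.univ_inter,
      Finset.prod_mul_distrib, ← Finset.prod_filter, ← Finset.prod_filter, Finset.prod_const,
      Finset.prod_const, inv_pow, ← div_eq_mul_inv, one_le_div (by positivity)]
    exact pow_le_pow_right₀ (by linarith) hb
  · rw [← Finset.prod_filter, Finset.filter_mem_eq_inter, Finset.univ_inter, Finset.prod_const,
      ← Real.exp_nat_mul, div_one]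
    refine ENNReal.ofReal_le_ofReal (Real.exp_le_exp.2 (le_of_eq ?_))
    ring

/-- The number of disagreements of `h` with the sample `S`. -/
def sampleDisagreements (h : X → Bool) (S : ι → X × Bool) : ℕ :=
  (Finset.univ.filter fun i => h (S i).1 ≠ (S i).2).card

lemma disagreements_ofFn (h : X → Bool) {n : ℕ} (S : Fin n → X × Bool) :
    disagreements h (List.ofFn S) = sampleDisagreements h S := by
  rw [disagreements, sampleDisagreements, Finset.card_filter]
  induction n with
  | zero => simp
  | succ n ih =>
    rw [List.ofFn_succ, List.countP_cons, ih, Fin.sum_univ_succ, add_comm]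
    simp

/-- The labelled sample with points `x` whose labels are those of `g`, flipped where `b` says so. -/
def flipLabels (g : X → Bool) (q : (ι → X) × (ι → Bool)) (i : ι) : X × Bool :=
  (q.1 i, xor (g (q.1 i)) (q.2 i))

/-- Outside `diffSet` both classifiers err together; inside it exactly one errs, `h` on the
unflipped labels and `g` on the flipped ones. -/
lemma sampleDisagreements_flipLabels_le_iff [DecidableEq ι] (g h : X → Bool)
    (q : (ι → X) × (ι → Bool)) :
    sampleDisagreements h (flipLabels g q) ≤ sampleDisagreements g (flipLabels g q) ↔
      ((diffSet g h q.1).filter fun i => q.2 i = false).card ≤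
        ((diffSet g h q.1).filter fun i => q.2 i = true).card := by
  have hbool : ∀ a b c : Bool,
      ((if a ≠ xor b c then 1 else 0) + if a ≠ b ∧ c = true then 1 else 0) =
      (if b ≠ xor b c then 1 else 0) + if a ≠ b ∧ c = false then 1 else 0 := by decide
  have : sampleDisagreements h (flipLabels g q) +
      ((diffSet g h q.1).filter fun i => q.2 i = true).card =
      sampleDisagreements g (flipLabels g q) +
        ((diffSet g h q.1).filter fun i => q.2 i = false).card := by
    simp only [sampleDisagreements, diffSet, Finset.filter_filter, Finset.card_filter]
    rw [← Finset.sum_add_distrib, ← Finset.sum_add_distrib]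
    refine Finset.sum_congr rfl fun i _ => ?_
    exact hbool _ _ _
  omega

variable [MeasurableSpace X]

lemma measurePreserving_flipLabels (D : Measure X) [IsProbabilityMeasure D] {η : ℝ} (h0 : 0 ≤ η)
    (h1 : η ≤ 1) {g : X → Bool} (hg : Measurable g) :
    MeasurePreserving (flipLabels (ι := ι) g)
      ((Measure.pi fun _ : ι => D).prod (Measure.pi fun _ : ι => bern η))
      (Measure.pi fun _ : ι => noisyEX D η g) := by
  have := isProbabilityMeasure_bern h0 h1
  have hm : Measurable fun p : X × Bool => (p.1, xor (g p.1) p.2) := by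
    refine measurable_fst.prodMk ?_
    exact (measurable_of_countable fun q : Bool × Bool => xor q.1 q.2).comp
      ((hg.comp measurable_fst).prodMk measurable_snd)
  have hmp : MeasurePreserving (fun p : X × Bool => (p.1, xor (g p.1) p.2)) (D.prod (bern η))
      (noisyEX D η g) := ⟨hm, (noisyEX_eq_map D η hg).symm⟩
  have : IsProbabilityMeasure (noisyEX D η g) := by
    rw [← hmp.map_eq]
    exact Measure.isProbabilityMeasure_map hm.aemeasurable
  exact (measurePreserving_pi (fun _ : ι => D.prod (bern η)) (fun _ : ι => noisyEX D η g)
    fun _ => hmp).comp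
    (measurePreserving_arrowProdEquivProdArrow X Bool ι (fun _ => D) fun _ => bern η).symm

lemma measurableSet_sampleDisagreements_le {g h : X → Bool} (hg : Measurable g)
    (hh : Measurable h) :
    MeasurableSet {S : ι → X × Bool | sampleDisagreements h S ≤ sampleDisagreements g S} := by
  have key : ∀ f : X → Bool, Measurable f → Measurable (sampleDisagreements (ι := ι) f) := by
    intro f hf
    have : sampleDisagreements (ι := ι) f =
        fun S => ∑ i, if f (S i).1 ≠ (S i).2 then 1 else 0 := by
      funext S
      rw [sampleDisagreements, Finset.card_filter]
    rw [this]
    refine Finset.measurable_sum _ fun i _ => Measurable.ite ?_ measurable_const measurable_const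
    exact (measurableSet_eq_fun ((hf.comp measurable_fst).comp (measurable_pi_apply i))
      (measurable_snd.comp (measurable_pi_apply i))).compl
  exact measurableSet_le (key h hh) (key g hg)

/-- It is unlikely that a classifier of error at least `ε` fits the noisy sample as well as the
target does. -/
lemma measure_exists_sampleDisagreements_le {H : Set (X → Bool)} {d : ℕ} (hd : HasVCDim H d)
    (D : Measure X) [IsProbabilityMeasure D] {g : X → Bool} (hg : Measurable g)
    {K : Set (X → Bool)} (hKH : K ⊆ H) (hK : K.Countable) (hKm : ∀ h ∈ K, Measurable h)
    {η β ε : ℝ} (h0 : 0 ≤ η) (hβ : 0 < β) (hηβ : β ≤ 1 - 2 * η) (hKε : ∀ h ∈ K, ε ≤ cleanErr D g h)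
    (hn : 3 ≤ Fintype.card ι * ε) :
    (Measure.pi fun _ : ι => noisyEX D η g)
      {S | ∃ h ∈ K, sampleDisagreements h S ≤ sampleDisagreements g S} ≤
      ENNReal.ofReal (3 * (2 * Fintype.card ι + 1) ^ d *
        Real.exp (-(Fintype.card ι * ε * β ^ 2 / 32))) := by
  classical
  have h1 : η ≤ 1 := by linarith
  have hβ1 : β ≤ 1 := by linarith
  have := isProbabilityMeasure_bern h0 h1
  set n : ℝ := (Fintype.card ι : ℝ)
  have hn0 : 0 ≤ n := Nat.cast_nonneg _
  set t : ℝ := n * ε / 16 with ht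
  set μ := Measure.pi fun _ : ι => D
  set ν := Measure.pi fun _ : ι => bern η
  have hmp := measurePreserving_flipLabels (ι := ι) D h0 h1 hg
  have hBm : MeasurableSet {S : ι → X × Bool |
      ∃ h ∈ K, sampleDisagreements h S ≤ sampleDisagreements g S} := by
    have : {S : ι → X × Bool | ∃ h ∈ K, sampleDisagreements h S ≤ sampleDisagreements g S} =
        ⋃ h ∈ K, {S | sampleDisagreements h S ≤ sampleDisagreements g S} := by
      ext S
      simp only [Set.mem_iUnion, Set.mem_ofPred_eq, exists_prop]
    rw [this]
    exact MeasurableSet.biUnion hK fun h hh => measurableSet_sampleDisagreements_le hg (hKm h hh)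
  rw [← hmp.measure_preimage hBm.nullMeasurableSet]
  -- Either some bad classifier differs from the target at no more than `t` points, or one differing
  -- at `t` or more points is favoured by the flips.
  set E₁ : Set (ι → X) := {x | ∃ h ∈ K, ((diffSet g h x).card : ℝ) ≤ t}
  set E₂ : Set ((ι → X) × (ι → Bool)) := ⋃ h ∈ K, {q | t ≤ ((diffSet g h q.1).card : ℝ)} ∩
    flipLabels g ⁻¹' {S | sampleDisagreements h S ≤ sampleDisagreements g S} with hE₂
  have hE₂m : MeasurableSet E₂ := MeasurableSet.biUnion hK fun h hh => MeasurableSet.inter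
    (measurableSet_le measurable_const
      ((measurable_card_diffSet hg (hKm h hh)).comp measurable_fst))
    (hmp.measurable (measurableSet_sampleDisagreements_le hg (hKm h hh)))
  have hsub : flipLabels (ι := ι) g ⁻¹'
      {S | ∃ h ∈ K, sampleDisagreements h S ≤ sampleDisagreements g S} ⊆
      E₁ ×ˢ Set.univ ∪ E₂ := by
    rintro q ⟨h, hh, hq⟩
    rcases le_total ((diffSet g h q.1).card : ℝ) t with hc | hc
    · exact Or.inl ⟨⟨h, hh, hc⟩, Set.mem_univ _⟩
    · exact Or.inr (Set.mem_biUnion hh ⟨hc, hq⟩)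
  have hbound₁ : μ E₁ ≤ ENNReal.ofReal (2 * ((2 * n + 1) ^ d * Real.exp (-(t / 2)))) := by
    refine measure_exists_card_diffSet_le hd D hg hKH hK hKm (fun h hh => ?_) fun h hh => ?_
    · have := mul_le_mul_of_nonneg_left (hKε h hh) hn0
      rw [ht]
      linarith
    · exact hn.trans (mul_le_mul_of_nonneg_left (hKε h hh) hn0)
  have hbound₂ : (μ.prod ν) E₂ ≤
      ENNReal.ofReal ((n + 1) ^ d * Real.exp (-(t * β ^ 2 / 2))) := by
    rw [Measure.prod_apply hE₂m]
    refine (lintegral_mono (g := fun _ =>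
      ENNReal.ofReal ((n + 1) ^ d * Real.exp (-(t * β ^ 2 / 2)))) fun x => ?_).trans (by simp [μ])
    -- With `x` fixed, the event depends on `h` only through its pattern, so finitely many Chernoff
    -- bounds suffice.
    have hsub' : Prod.mk x ⁻¹' E₂ ⊆ ⋃ I ∈ (patterns H g x).filter fun I => t ≤ (I.card : ℝ),
        {b | (I.filter fun i => b i = false).card ≤ (I.filter fun i => b i = true).card} := by
      intro b hb
      rw [Set.mem_preimage, hE₂, Set.mem_iUnion₂] at hb
      obtain ⟨h, hh, hc, hq⟩ := hb
      exact Set.mem_biUnion (x := diffSet g h x)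
        (Finset.mem_coe.2 (Finset.mem_filter.2 ⟨mem_patterns.2 ⟨h, hKH hh, rfl⟩, hc⟩))
        ((sampleDisagreements_flipLabels_le_iff g h (x, b)).1 hq)
    refine (measure_mono hsub').trans ((measure_biUnion_finset_le _ _).trans
      ((Finset.sum_le_sum (g := fun _ => ENNReal.ofReal (Real.exp (-(t * β ^ 2 / 2))))
        fun I hI => (measure_flips_le I h0 hβ hηβ).trans ?_).trans ?_))
    · have := (Finset.mem_filter.1 hI).2
      refine ENNReal.ofReal_le_ofReal (Real.exp_le_exp.2 ?_)
      nlinarith [sq_nonneg β]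
    · rw [Finset.sum_const, nsmul_eq_mul, ENNReal.ofReal_mul (by positivity)]
      refine mul_le_mul_left ?_ _
      rw [← ENNReal.ofReal_natCast]
      refine ENNReal.ofReal_le_ofReal ?_
      refine (Nat.cast_le.2 ((Finset.card_filter_le _ _).trans (card_patterns_le hd g x))).trans
        (le_of_eq ?_)
      push_cast
      rfl
  refine (measure_mono hsub).trans ((measure_union_le _ _).trans ?_)
  rw [Measure.prod_prod, measure_univ, mul_one]
  refine (add_le_add hbound₁ hbound₂).trans ?_
  rw [← ENNReal.ofReal_add (by positivity) (by positivity)]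
  refine ENNReal.ofReal_le_ofReal ?_
  have ht0 : 0 ≤ t := by rw [ht]; linarith
  have e1 : Real.exp (-(t / 2)) ≤ Real.exp (-(n * ε * β ^ 2 / 32)) := by
    refine Real.exp_le_exp.2 ?_
    have : β ^ 2 ≤ 1 := by nlinarith
    have : t * β ^ 2 ≤ t * 1 := by gcongr
    rw [show n * ε * β ^ 2 / 32 = t * β ^ 2 / 2 by rw [ht]; ring]
    linarith
  have e2 : Real.exp (-(t * β ^ 2 / 2)) = Real.exp (-(n * ε * β ^ 2 / 32)) := by
    rw [ht]; ring_nf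
  have e3 : (n + 1) ^ d ≤ (2 * n + 1) ^ d := by gcongr; linarith
  rw [e2]
  calc _ ≤ 2 * ((2 * n + 1) ^ d * Real.exp (-(n * ε * β ^ 2 / 32))) +
        (2 * n + 1) ^ d * Real.exp (-(n * ε * β ^ 2 / 32)) := by gcongr
    _ = _ := by ring

/-- The tail bound for empirical risk minimization with classification noise. -/
theorem measure_erm_le {H : Set (X → Bool)} {d : ℕ} (hH : WellBehaved H) (hd : HasVCDim H d)
    (D : Measure X) [IsProbabilityMeasure D] {g : X → Bool} (hgH : g ∈ H)
    {A : List (X × Bool) → X → Bool} (hA : IsERM H A) {η β ε : ℝ} (h0 : 0 ≤ η) (hβ : 0 < β)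
    (hηβ : β ≤ 1 - 2 * η) (hε : 0 < ε) {n : ℕ} (hn : 6 ≤ n * ε) :
    (Measure.pi fun _ : Fin n => noisyEX D η g)
      {S | ε ≤ cleanErr D g (A (List.ofFn S))} ≤
      ENNReal.ofReal (3 * (2 * n + 1) ^ d * Real.exp (-(n * ε * β ^ 2 / 64))) := by
  obtain ⟨hm, H₀, hH₀, hcount, happrox⟩ := hH
  -- The ERM output need not lie in `H₀`, so it is replaced by an approximant of error at least `ε /
  -- 2`; this turns 32 into 64 and 3 into 6 in the bounds.
  have hK := measure_exists_sampleDisagreements_le (ι := Fin n) hd D (hm g hgH)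
    (K := {h ∈ H₀ | ε / 2 ≤ cleanErr D g h}) (fun h hh => hH₀ hh.1)
    (hcount.mono fun h hh => hh.1) (fun h hh => hm h (hH₀ hh.1)) h0 hβ hηβ (ε := ε / 2)
    (fun h hh => hh.2) (by rw [Fintype.card_fin]; linarith)
  rw [Fintype.card_fin] at hK
  refine (measure_mono fun S hS => ?_).trans (hK.trans (le_of_eq ?_))
  · obtain ⟨hAH, hAmin⟩ := hA (List.ofFn S)
    set h := A (List.ofFn S)
    obtain ⟨u, huH, hu⟩ := happrox h hAH
    have hlim : Tendsto (fun j => cleanErr D g (u j)) atTop (nhds (cleanErr D g h)) := by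
      have := tendsto_measure_of_tendsto_indicator_of_isFiniteMeasure (L := atTop)
        (A := {x | h x ≠ g x}) (As := fun j => {x | u j x ≠ g x}) D
        (fun j => (measurableSet_eq_fun (hm _ (hH₀ (huH j))) (hm g hgH)).compl)
        (fun x => by
          filter_upwards [hu x] with j hj
          simp only [hj])
      exact (ENNReal.tendsto_toReal (measure_ne_top _ _)).comp this
    have hev : ∀ᶠ j in atTop, ε / 2 < cleanErr D g (u j) :=
      hlim.eventually_const_lt (lt_of_lt_of_le (by linarith) (show ε ≤ cleanErr D g h from hS))
    -- Agreement at the finitely many sample points suffices for equal disagreement counts.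
    have hevS : ∀ᶠ j in atTop, ∀ i, u j (S i).1 = h (S i).1 := eventually_all.2 fun i => hu _
    obtain ⟨j, hj, hjS⟩ := (hev.and hevS).exists
    refine ⟨u j, ⟨huH j, hj.le⟩, ?_⟩
    have := hAmin g hgH
    rw [disagreements_ofFn, disagreements_ofFn] at this
    convert this using 1
    simp only [sampleDisagreements, hjS]
  · ring_nf

end Noise

/-! ### From the tail bound to the sample complexity -/

section SampleSize

variable {X : Type*} [MeasurableSpace X] {H : Set (X → Bool)}

lemma cleanErr_le_one (D : Measure X) [IsProbabilityMeasure D] (g h : X → Bool) :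
    cleanErr D g h ≤ 1 := measureReal_le_one

lemma sufficientSize_zero_of_one_lt (H : Set (X → Bool)) {ε : ℝ} (hε : 1 < ε) (δ η : ℝ) :
    SufficientSize H ε δ η 0 := by
  intro n _ D hD g _ A _
  have : {S : Fin n → X × Bool | ε ≤ cleanErr D g (A (List.ofFn S))} = ∅ := by
    ext S
    simpa using (cleanErr_le_one D g _).trans_lt hε
  simp [this]

lemma subsingleton_of_hasVCDim_zero {X : Type*} {H : Set (X → Bool)} (hd : HasVCDim H 0) :
    H.Subsingleton := by
  classical
  intro f hf g hg
  by_contra hne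
  obtain ⟨x, hx⟩ := Function.ne_iff.1 hne
  have : 1 ≤ 0 := hd.2 ⟨{x}, by simp, fun u => by
    by_cases hux : f x = u x
    · exact ⟨f, hf, by simpa using hux⟩
    · refine ⟨g, hg, ?_⟩
      simp only [Finset.mem_singleton, forall_eq]
      revert hx hux
      cases f x <;> cases g x <;> cases u x <;> simp⟩
  omega

/-- The class has a single member, so ERM returns the target. Needed because the claimed sample
bound is 0 when `d = 0`. -/
lemma sufficientSize_zero_of_hasVCDim_zero (hd : HasVCDim H 0) {ε : ℝ} (hε : 0 < ε) (δ η : ℝ) :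
    SufficientSize H ε δ η 0 := by
  intro n _ D hD g hg A hA
  have : {S : Fin n → X × Bool | ε ≤ cleanErr D g (A (List.ofFn S))} = ∅ := by
    ext S
    have := subsingleton_of_hasVCDim_zero hd (hA (List.ofFn S)).1 hg
    simpa [cleanErr, this] using hε
  simp [this]

lemma three_mul_pow_mul_exp_le {d : ℕ} (hd : 1 ≤ d) {q δ : ℝ} (hq : 1 ≤ 512 * q) (hδ : 0 < δ)
    {n : ℝ} (hn : 128 * q * (1 + Real.log (512 * q) + Real.log (3 + 3 / δ)) ≤ n) :
    3 * (2 * n + 1) ^ d * Real.exp (-(n * (d / (64 * q)))) ≤ δ := by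
  have hq0 : 0 < q := by linarith
  have hd1 : (1 : ℝ) ≤ d := by exact_mod_cast hd
  have hl1 : 0 ≤ Real.log (512 * q) := Real.log_nonneg hq
  have hl2 : 0 ≤ Real.log (3 + 3 / δ) := Real.log_nonneg (by have : 0 < 3 / δ := by positivity
                                                             linarith)
  set l := 1 + Real.log (512 * q) + Real.log (3 + 3 / δ) with hl
  have hn0 : 0 ≤ n := le_trans (by positivity) hn
  -- Tangent line of the logarithm at `512 q`: its slope makes the linear term a quarter of the
  -- exponent `n / (64 q)`, so the exponent dominates.
  have hlog : Real.log (2 * n + 1) ≤ (2 * n + 1) / (512 * q) - 1 + Real.log (512 * q) := by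
    have h := Real.log_le_sub_one_of_pos (show 0 < (2 * n + 1) / (512 * q) by positivity)
    rw [Real.log_div (by positivity) (by positivity)] at h
    linarith
  have hlogδ : Real.log 3 - Real.log δ ≤ Real.log (3 + 3 / δ) := by
    rw [← Real.log_div (by norm_num) hδ.ne']
    exact Real.log_le_log (by positivity) (by linarith)
  have hnq : 2 * l ≤ n / (64 * q) := by
    rw [le_div_iff₀ (by positivity)]
    linarith
  have h512 : (2 * n + 1) / (512 * q) = (n / (64 * q)) / 4 + 1 / (512 * q) := by
    field_simp
    ring
  have hq1 : 1 / (512 * q) ≤ 1 := by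
    rw [div_le_one (by positivity)]
    exact hq
  have hkey : Real.log (3 * (2 * n + 1) ^ d * Real.exp (-(n * (d / (64 * q))))) ≤ Real.log δ := by
    rw [Real.log_mul (by positivity) (Real.exp_pos _).ne', Real.log_mul (by norm_num)
      (by positivity), Real.log_pow, Real.log_exp,
      show n * (d / (64 * q)) = d * (n / (64 * q)) by ring]
    set w := n / (64 * q)
    have h1 : Real.log (2 * n + 1) - w ≤ -Real.log (3 + 3 / δ) := by linarith
    have h2 : (d : ℝ) * (Real.log (2 * n + 1) - w) ≤ d * -Real.log (3 + 3 / δ) := by gcongr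
    nlinarith
  exact (Real.log_le_log_iff (by positivity) hδ).1 hkey

/-- The sample complexity bound for empirical risk minimization with classification noise. -/
theorem sufficientSize_of_le {d : ℕ} (hH : WellBehaved H) (hVC : HasVCDim H d) (hd : 1 ≤ d)
    {ε δ η β : ℝ} (hε : 0 < ε) (hε1 : ε ≤ 1) (hδ : 0 < δ) (h0 : 0 ≤ η) (hβ : 0 < β)
    (hηβ : β ≤ 1 - 2 * η) {m : ℕ}
    (hm : 128 * (d / (ε * β ^ 2)) *
      (1 + Real.log (512 * (d / (ε * β ^ 2))) + Real.log (3 + 3 / δ)) ≤ m) :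
    SufficientSize H ε δ η m := by
  intro n hmn D hD g hg A hA
  have hd1 : (1 : ℝ) ≤ d := by exact_mod_cast hd
  have hβ1 : β ^ 2 ≤ 1 := by nlinarith
  have hε' : ε * β ^ 2 ≤ ε := mul_le_of_le_one_right hε.le hβ1
  have hεβ : 0 < ε * β ^ 2 := by positivity
  set q := d / (ε * β ^ 2) with hq
  have hqε : 1 ≤ q * ε := by
    rw [hq, div_mul_eq_mul_div, le_div_iff₀ hεβ]
    nlinarith
  have hq1 : 1 ≤ q := by nlinarith [show 0 < q by positivity]
  have hmn' : (m : ℝ) ≤ n := by exact_mod_cast hmn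
  have hl1 : 0 ≤ Real.log (512 * q) := Real.log_nonneg (by linarith)
  have hl2 : 0 ≤ Real.log (3 + 3 / δ) := Real.log_nonneg (by have : 0 < 3 / δ := by positivity
                                                             linarith)
  have hn : 128 * q ≤ n := by
    refine le_trans ?_ (hm.trans hmn')
    nlinarith
  refine (measure_erm_le hH hVC D hg hA h0 hβ hηβ hε ?_).trans (ENNReal.ofReal_le_ofReal ?_)
  · nlinarith
  · have := three_mul_pow_mul_exp_le hd (q := q) (by linarith) hδ (hm.trans hmn')
    convert this using 4
    rw [hq]
    field_simp

theorem exists_sufficientSize {d : ℕ} (hH : WellBehaved H) (hVC : HasVCDim H d) {ε δ η : ℝ}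
    (hε : 0 < ε) (hδ : 0 < δ) (h0 : 0 ≤ η) (h1 : η < 1 / 2) : ∃ m, SufficientSize H ε δ η m := by
  rcases Nat.eq_zero_or_pos d with rfl | hd
  · exact ⟨0, sufficientSize_zero_of_hasVCDim_zero hVC hε δ η⟩
  rcases lt_or_ge 1 ε with hε1 | hε1
  · exact ⟨0, sufficientSize_zero_of_one_lt H hε1 δ η⟩
  obtain ⟨m, hm⟩ := exists_nat_ge (128 * (d / (ε * (1 - 2 * η) ^ 2)) *
    (1 + Real.log (512 * (d / (ε * (1 - 2 * η) ^ 2))) + Real.log (3 + 3 / δ)))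
  exact ⟨m, sufficientSize_of_le hH hVC hd hε hε1 hδ h0 (by linarith) le_rfl hm⟩

lemma half_lt_log_two : 1 / 2 < Real.log 2 := by linarith [Real.log_two_gt_d9]

lemma log_two_le_log_two_add {x : ℝ} (hx : 0 ≤ x) : Real.log 2 ≤ Real.log (2 + x) :=
  Real.log_le_log two_pos (by linarith)

/-- Absorbs constants: each factor 2 costs `log 2 ≤ log (2 + x)`. -/
lemma log_pow_two_mul_le {x y : ℝ} (hx : 0 ≤ x) (hy : 0 < y) (n : ℕ) (h : y ≤ 2 ^ n * (2 + x)) :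
    Real.log y ≤ (n + 1) * Real.log (2 + x) := by
  have h1 := Real.log_le_log hy h
  rw [Real.log_mul (by positivity) (by positivity), Real.log_pow] at h1
  have h2 : (n : ℝ) * Real.log 2 ≤ n * Real.log (2 + x) := by
    gcongr
    linarith
  linarith

lemma roundConf_pos {k : ℕ} (hk : 2 ≤ k) {δ : ℝ} (hδ : 0 < δ) : 0 < roundConf k δ :=
  div_pos hδ (mul_pos two_pos (Real.logb_pos one_lt_two (by exact_mod_cast hk)))

/-- Every summand is absorbed into `Λ` or `Δ`; as both exceed 1/2, sums can be replaced by multiples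
of the product. -/
lemma log_terms_le {k : ℕ} (hk : 2 ≤ k) {δ Q : ℝ} (hδ : 0 < δ) (hQ1 : 1 / 4 ≤ Q) :
    1 + Real.log (512 * (4 * Q)) + Real.log (3 + 3 / roundConf k δ) ≤
      48 * Real.log (2 + Real.log k * Q) * Real.log (2 + 1 / δ) := by
  have hlog2 := half_lt_log_two
  have hL : Real.log 2 ≤ Real.log k := Real.log_le_log two_pos (by exact_mod_cast hk)
  have hconf := roundConf_pos hk hδ
  have hconf_eq : roundConf k δ = δ / (2 * (Real.log k / Real.log 2)) := rfl
  set L := Real.log k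
  have hF0 : 0 ≤ L * Q := mul_nonneg (by linarith) (by linarith)
  set Λ := Real.log (2 + L * Q) with hΛ
  set Δ := Real.log (2 + 1 / δ) with hΔ
  have hΛ1 : 1 / 2 < Λ := hlog2.trans_le (log_two_le_log_two_add hF0)
  have hΔ1 : 1 / 2 < Δ := hlog2.trans_le (log_two_le_log_two_add (by positivity))
  have hlogQ : Real.log (512 * (4 * Q)) ≤ 13 * Λ := by
    have := log_pow_two_mul_le hF0 (y := 512 * (4 * Q)) (by positivity) 12
      (by norm_num; nlinarith)
    norm_num at this
    linarith
  have hlogL : Real.log L ≤ 3 * Λ := by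
    have := log_pow_two_mul_le hF0 (y := L) (by linarith) 2 (by nlinarith)
    norm_num at this
    linarith
  have hlog18 : Real.log 18 ≤ 5 * Λ := by
    have := log_pow_two_mul_le hF0 (y := 18) (by norm_num) 4 (by nlinarith)
    norm_num at this
    linarith
  have hlogδ : Real.log (3 + 3 / roundConf k δ) ≤ 8 * Λ + Δ := by
    have hle : 3 + 3 / roundConf k δ ≤ 18 * L * (2 + 1 / δ) := by
      have h1 : 3 / roundConf k δ = 6 * (L / Real.log 2) * (1 / δ) := by
        rw [hconf_eq]
        have : L ≠ 0 := by linarith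
        field_simp
        ring
      have h2 : L / Real.log 2 ≤ 2 * L := by
        rw [div_le_iff₀ (by linarith)]
        nlinarith
      have h3 : 6 * (L / Real.log 2) * (1 / δ) ≤ 6 * (2 * L) * (1 / δ) := by gcongr
      have h4 : 0 ≤ L * (1 / δ) := mul_nonneg (by linarith) (by positivity)
      rw [h1]
      nlinarith
    have hL0 : 0 < L := by linarith
    have := Real.log_le_log (by positivity) hle
    rw [Real.log_mul (by positivity) (by positivity), Real.log_mul (by norm_num) hL0.ne'] at this
    linarith
  nlinarith

/-- The sample size of a round, in terms of the quantities in the statement. -/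
lemma sampleComplexity_round_le {d : ℕ} (hH : WellBehaved H) (hVC : HasVCDim H d) {k : ℕ}
    (hk : 2 ≤ k) {ε δ η β : ℝ} (hε : 0 < ε) (hδ : 0 < δ) (h0 : 0 ≤ η) (hβ : 0 < β)
    (hηβ : β ≤ 1 - 2 * η) :
    (sampleComplexity H (ε / 4) (roundConf k δ) η : ℝ) ≤
      24592 * (d / (ε * β ^ 2)) * Real.log (2 + Real.log k * (d / (ε * β ^ 2))) *
        Real.log (2 + 1 / δ) := by
  have hlog2 := half_lt_log_two
  have hL : Real.log 2 ≤ Real.log k := Real.log_le_log two_pos (by exact_mod_cast hk)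
  set Q := d / (ε * β ^ 2) with hQ
  set L := Real.log k
  have hQ0 : 0 ≤ Q := by positivity
  have hF0 : 0 ≤ L * Q := mul_nonneg (by linarith) hQ0
  set Λ := Real.log (2 + L * Q) with hΛ
  set Δ := Real.log (2 + 1 / δ) with hΔ
  have hΛ1 : 1 / 2 < Λ := hlog2.trans_le (log_two_le_log_two_add hF0)
  have hΔ1 : 1 / 2 < Δ := hlog2.trans_le (log_two_le_log_two_add (by positivity))
  rcases Nat.eq_zero_or_pos d with rfl | hd
  · have : sampleComplexity H (ε / 4) (roundConf k δ) η = 0 := Nat.le_zero.1 (Nat.sInf_le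
      (sufficientSize_zero_of_hasVCDim_zero hVC (by positivity) _ _))
    rw [this]
    simp only [Nat.cast_zero]
    positivity
  -- For large `ε` the quantity `Q` may be arbitrarily small and could not absorb the rounding up;
  -- then no examples are needed.
  rcases lt_or_ge 1 (ε / 4) with hε1 | hε1
  · have : sampleComplexity H (ε / 4) (roundConf k δ) η = 0 := Nat.le_zero.1 (Nat.sInf_le
      (sufficientSize_zero_of_one_lt H hε1 _ _))
    rw [this]
    simp only [Nat.cast_zero]
    positivity
  have hd1 : (1 : ℝ) ≤ d := by exact_mod_cast hd
  have hβ1 : β ^ 2 ≤ 1 := by nlinarith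
  have hεβ : 0 < ε * β ^ 2 := by positivity
  have hQ1 : 1 / 4 ≤ Q := by
    rw [hQ, le_div_iff₀ hεβ]
    nlinarith
  have hconf := roundConf_pos hk hδ
  have hq4 : d / (ε / 4 * β ^ 2) = 4 * Q := by
    rw [hQ]
    field_simp
  have hB := log_terms_le hk hδ hQ1
  have hsize := sufficientSize_of_le hH hVC hd (by positivity) hε1 hconf h0 hβ hηβ
    (Nat.le_ceil (128 * (d / (ε / 4 * β ^ 2)) * (1 + Real.log (512 * (d / (ε / 4 * β ^ 2))) +
      Real.log (3 + 3 / roundConf k δ))))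
  rw [hq4] at hsize
  have hle : sampleComplexity H (ε / 4) (roundConf k δ) η ≤ _ := Nat.sInf_le hsize
  have hmono : 128 * (4 * Q) * (1 + Real.log (512 * (4 * Q)) +
      Real.log (3 + 3 / roundConf k δ)) ≤ 128 * (4 * Q) * (48 * Λ * Δ) := by gcongr
  have hΛΔ : 1 / 4 ≤ Λ * Δ := by nlinarith
  -- The `+ 1` from the ceiling costs at most `16 Q Λ Δ`, whence `24592 = 128 * 4 * 48 + 16`.
  have hQΛΔ : 1 / 16 ≤ Q * (Λ * Δ) := by nlinarith
  calc (sampleComplexity H (ε / 4) (roundConf k δ) η : ℝ) ≤ _ := Nat.cast_le.2 (hle.trans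
        (Nat.ceil_mono hmono))
    _ ≤ 128 * (4 * Q) * (48 * Λ * Δ) + 1 := (Nat.ceil_lt_add_one (by positivity)).le
    _ ≤ _ := by nlinarith

end SampleSize

/-! ### Counting blackboard symbols per round -/

section Communication

variable {X : Type*} {k : ℕ}

lemma nodup_members (N : Finset (Fin k)) : (members N).Nodup :=
  (List.nodup_finRange k).filter _

lemma toFinset_members (N : Finset (Fin k)) : (members N).toFinset = N := by
  ext i
  simp [members]

lemma sum_map_members (N : Finset (Fin k)) (f : Fin k → ℕ) :
    ((members N).map f).sum = ∑ i ∈ N, f i := by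
  rw [← List.sum_toFinset f (nodup_members N), toFinset_members]

lemma length_members (N : Finset (Fin k)) : (members N).length = N.card := by
  rw [← List.toFinset_card_of_nodup (nodup_members N), toFinset_members]

lemma length_encodeNat (n : ℕ) : (encodeNat n).length = 2 * n.size + 1 := by
  simp [encodeNat, List.length_flatMap, Nat.size_eq_bits_len, mul_comm]

/-- Each entry is assigned to a single player and hence counted at most once. -/
lemma sum_length_filter_eq_le (N : Finset (Fin k)) (f : ℕ → Fin k) (l : List ℕ) :
    ∑ i ∈ N, (l.filter fun t => f t = i).length ≤ l.length := by
  induction l with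
  | nil => simp
  | cons t l ih =>
    have : ∀ i, ((t :: l).filter fun t => f t = i).length =
        (l.filter fun t => f t = i).length + if f t = i then 1 else 0 := by
      intro i
      by_cases h : f t = i <;> simp [h]
    simp_rw [this, Finset.sum_add_distrib, Finset.sum_ite_eq, List.length_cons]
    split_ifs <;> omega

lemma sum_length_slots_le (ω : Draws X k) (j m : ℕ) (N : Finset (Fin k)) (hN : N.Nonempty) :
    ∑ i ∈ N, (slots ω j m N hN i).length ≤ m := by
  simpa [slots] using sum_length_filter_eq_le N (fun t => ω.pick j t N hN) (List.range m)

lemma length_slots_le (ω : Draws X k) (j m : ℕ) (N : Finset (Fin k)) (hN : N.Nonempty)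
    (i : Fin k) : (slots ω j m N hN i).length ≤ m := by
  simpa [slots] using List.length_filter_le (fun t => (ω.pick j t N hN : Fin k) = i) (List.range m)

lemma countP_isBit_map_bit (l : List Bool) :
    (l.map (Symb.bit (X := X))).countP Symb.isBit = l.length := by
  rw [List.countP_map, List.countP_eq_length]
  simp [Symb.isBit]

lemma countP_isBit_map_example (l : List (X × Bool)) :
    (l.map Symb.example_).countP Symb.isBit = 0 := by
  rw [List.countP_map, List.countP_eq_zero]
  simp [Symb.isBit]

lemma countP_isExample_map_bit (l : List Bool) :
    (l.map (Symb.bit (X := X))).countP Symb.isExample = 0 := by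
  rw [List.countP_map, List.countP_eq_zero]
  simp [Symb.isExample]

lemma countP_isExample_map_example (l : List (X × Bool)) :
    (l.map Symb.example_).countP Symb.isExample = l.length := by
  rw [List.countP_map, List.countP_eq_length]
  simp [Symb.isExample]

variable [MeasurableSpace X] {H : Set (X → Bool)} {c ε δ : ℝ} {η : Fin k → ℝ}
  {A : List (X × Bool) → X → Bool} {ω : Draws X k}

lemma countP_isExample_round_le {M : ℕ}
    (hM : ∀ N : Finset (Fin k), N.Nonempty →
      sampleComplexity H (ε / 4) (roundConf k δ) (avgNoise η N) ≤ M) (j : ℕ) (s : State X k) :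
    (round H c ε δ η A ω j s).board.countP Symb.isExample ≤
      s.board.countP Symb.isExample + M := by
  unfold round
  split_ifs with hN
  · simp only [List.countP_append, countP_isExample_map_bit, countP_isExample_map_example,
      List.length_flatMap, List.length_map, add_zero]
    rw [sum_map_members]
    gcongr
    exact (sum_length_slots_le _ _ _ _ _).trans (hM _ hN)
  · omega

/-- Each of at most `k` active players accounts for `2 * M.size + 1` request bits at most and one
verdict bit. -/
lemma countP_isBit_round_le {M : ℕ}
    (hM : ∀ N : Finset (Fin k), N.Nonempty →
      sampleComplexity H (ε / 4) (roundConf k δ) (avgNoise η N) ≤ M) (j : ℕ) (s : State X k) :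
    (round H c ε δ η A ω j s).board.countP Symb.isBit ≤
      s.board.countP Symb.isBit + k * (2 * M.size + 2) := by
  unfold round
  split_ifs with hN
  · simp only [List.countP_append, countP_isBit_map_bit, countP_isBit_map_example,
      List.length_flatMap, List.length_map, add_zero, length_encodeNat, length_members]
    rw [sum_map_members, add_assoc]
    have hcard : s.active.card ≤ k := by simpa using Finset.card_le_univ s.active
    have hsum : ∑ i ∈ s.active, (2 * (slots ω j (sampleComplexity H (ε / 4) (roundConf k δ)
        (avgNoise η s.active)) s.active hN i).length.size + 1) ≤
        ∑ _i ∈ s.active, (2 * M.size + 1) := by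
      gcongr
      exact Nat.size_le_size ((length_slots_le _ _ _ _ _ _).trans (hM _ hN))
    rw [Finset.sum_const, smul_eq_mul] at hsum
    nlinarith
  · omega

lemma countP_isExample_stateAfter_le {M : ℕ}
    (hM : ∀ N : Finset (Fin k), N.Nonempty →
      sampleComplexity H (ε / 4) (roundConf k δ) (avgNoise η N) ≤ M) (n : ℕ) :
    (stateAfter H c ε δ η A ω n).board.countP Symb.isExample ≤ n * M := by
  induction n with
  | zero => simp [stateAfter]
  | succ n ih =>
    rw [add_mul, one_mul]
    exact (countP_isExample_round_le hM _ _).trans (by gcongr)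

lemma countP_isBit_stateAfter_le {M : ℕ}
    (hM : ∀ N : Finset (Fin k), N.Nonempty →
      sampleComplexity H (ε / 4) (roundConf k δ) (avgNoise η N) ≤ M) (n : ℕ) :
    (stateAfter H c ε δ η A ω n).board.countP Symb.isBit ≤ n * (k * (2 * M.size + 2)) := by
  induction n with
  | zero => simp [stateAfter]
  | succ n ih =>
    rw [add_mul, one_mul]
    exact (countP_isBit_round_le hM _ _).trans (by gcongr)

lemma avgNoise_nonneg {η : Fin k → ℝ} (h0 : ∀ i, 0 ≤ η i) (N : Finset (Fin k)) :
    0 ≤ avgNoise η N :=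
  div_nonneg (Finset.sum_nonneg fun i _ => h0 i) (Nat.cast_nonneg _)

lemma avgNoise_le_maxNoise (η : Fin k → ℝ) {N : Finset (Fin k)} (hN : N.Nonempty) :
    avgNoise η N ≤ maxNoise η := by
  rw [avgNoise, div_le_iff₀ (by exact_mod_cast hN.card_pos)]
  calc ∑ i ∈ N, η i ≤ ∑ _i ∈ N, maxNoise η :=
        Finset.sum_le_sum fun i _ => le_ciSup (Set.finite_range η).bddAbove i
    _ = _ := by rw [Finset.sum_const, nsmul_eq_mul, mul_comm]

lemma maxNoise_lt_half {η : Fin k → ℝ} (h : ∀ i, η i < 1 / 2) : maxNoise η < 1 / 2 := by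
  rcases isEmpty_or_nonempty (Fin k) with hk | hk
  -- With no players the real supremum takes its default value 0.
  · rw [maxNoise, Real.iSup_of_isEmpty]
    norm_num
  · obtain ⟨i, hi⟩ := exists_eq_ciSup_of_finite (f := η)
    rw [maxNoise, ← hi]
    exact h i

/-- Minimality gives `2 ^ (clog - 1) < k`, so `clog ≤ 1 + 2 log k`, and `1 ≤ 2 log k` since `k ≥ 2`.
-/
lemma clog_two_le {k : ℕ} (hk : 2 ≤ k) : (Nat.clog 2 k : ℝ) ≤ 4 * Real.log k := by
  have h1 : 2 ^ (Nat.clog 2 k - 1) ≤ k := (Nat.pow_pred_clog_lt_self one_lt_two hk).le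
  have hpos : 0 < Nat.clog 2 k := Nat.clog_pos one_lt_two hk
  have h2 := Real.log_le_log (by positivity)
    (show ((2 : ℝ) ^ (Nat.clog 2 k - 1)) ≤ k by exact_mod_cast h1)
  rw [Real.log_pow, Nat.cast_pred hpos] at h2
  have hL : Real.log 2 ≤ Real.log k := Real.log_le_log two_pos (by exact_mod_cast hk)
  have hlog2 := half_lt_log_two
  have hc : (1 : ℝ) ≤ Nat.clog 2 k := by exact_mod_cast hpos
  nlinarith

lemma size_le_log (m : ℕ) : (m.size : ℝ) ≤ 2 * Real.log (m + 1) + 1 := by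
  rcases Nat.eq_zero_or_pos m with rfl | hm
  · simp
  have hpos : 0 < m.size := Nat.size_pos.2 hm
  have h1 : 2 ^ (m.size - 1) ≤ m := Nat.lt_size.1 (by omega)
  have h2 := Real.log_le_log (by positivity)
    (show ((2 : ℝ) ^ (m.size - 1)) ≤ m + 1 by exact_mod_cast h1.trans (Nat.le_succ m))
  rw [Real.log_pow, Nat.cast_pred hpos] at h2
  have hlog2 := half_lt_log_two
  have hc : (1 : ℝ) ≤ m.size := by exact_mod_cast hpos
  nlinarith

/-- The length of `M` is logarithmic, so the factors of its bound become summands. The `log k`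
inside `Λ` is charged to `log (2 + G)`, and the sum becomes a product because every factor exceeds
1/2. -/
lemma size_bound {k M : ℕ} (hk : 2 ≤ k) {Q Δ : ℝ} (hQ : 0 ≤ Q) (hΔ : 1 / 2 < Δ)
    (hM : (M : ℝ) ≤ 24592 * Q * Real.log (2 + Real.log k * Q) * Δ) :
    2 * (M.size : ℝ) + 2 ≤
      464 * Real.log (2 + Q) * Real.log (2 + k * Real.log (2 + Q)) * Δ := by
  have hlog2 := half_lt_log_two
  have hL : Real.log 2 ≤ Real.log k := Real.log_le_log two_pos (by exact_mod_cast hk)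
  have hk2 : (2 : ℝ) ≤ k := by exact_mod_cast hk
  have hLk : Real.log k ≤ k := (Real.log_le_sub_one_of_pos (by linarith)).trans (by linarith)
  set L := Real.log k
  set ℓ := Real.log (2 + Q) with hℓ
  have hℓ1 : 1 / 2 < ℓ := hlog2.trans_le (log_two_le_log_two_add hQ)
  have hG0 : 0 ≤ k * ℓ := by positivity
  set Γ := Real.log (2 + k * ℓ) with hΓ
  have hΓ1 : 1 / 2 < Γ := hlog2.trans_le (log_two_le_log_two_add hG0)
  have hL0 : 0 < L := by linarith
  have hF0 : 0 ≤ L * Q := by positivity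
  set Λ := Real.log (2 + L * Q) with hΛ
  have hΛ1 : 1 / 2 < Λ := hlog2.trans_le (log_two_le_log_two_add hF0)
  have hlogL : Real.log (2 + L) ≤ 2 * Γ := by
    have := log_pow_two_mul_le hG0 (y := 2 + L) (by linarith) 1 (by nlinarith)
    norm_num at this
    linarith
  have hΛle : Λ ≤ 2 * Γ + ℓ := by
    have h := Real.log_le_log (show 0 < 2 + L * Q by positivity)
      (show 2 + L * Q ≤ (2 + L) * (2 + Q) by nlinarith)
    rw [Real.log_mul (by positivity) (by positivity)] at h
    linarith
  have hlogM : Real.log (M + 1) ≤ 11 + ℓ + Λ + Δ := by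
    have h1 : (M : ℝ) + 1 ≤ 2 ^ 15 * (2 + Q) * (1 + Λ) * (1 + Δ) := by
      have hQΛ : Q * Λ ≤ (2 + Q) * (1 + Λ) := by nlinarith
      have h2 : Q * Λ * Δ ≤ (2 + Q) * (1 + Λ) * Δ := by gcongr
      have h3 : 2 ≤ (2 + Q) * (1 + Λ) := by nlinarith
      nlinarith
    have h := Real.log_le_log (by positivity) h1
    rw [Real.log_mul (by positivity) (by positivity), Real.log_mul (by positivity)
      (by positivity), Real.log_mul (by positivity) (by positivity), Real.log_pow] at h
    have h4 := Real.log_le_sub_one_of_pos (show 0 < 1 + Λ by positivity)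
    have h5 := Real.log_le_sub_one_of_pos (show 0 < 1 + Δ by positivity)
    have h6 := Real.log_two_lt_d9
    norm_num at h
    linarith
  have hsize := size_le_log M
  have e1 : 1 / 4 ≤ ℓ * Γ := by nlinarith
  have e2 : 1 / 4 ≤ Γ * Δ := by nlinarith
  have e3 : 1 / 4 ≤ ℓ * Δ := by nlinarith
  have f1 : ℓ ≤ 4 * (ℓ * Γ * Δ) := by nlinarith
  have f2 : Γ ≤ 4 * (ℓ * Γ * Δ) := by nlinarith
  have f3 : Δ ≤ 4 * (ℓ * Γ * Δ) := by nlinarith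
  have f4 : 1 ≤ 8 * (ℓ * Γ * Δ) := by nlinarith
  linarith

end Communication

lemma softBound_nonneg {C δ F : ℝ} (hC : 0 ≤ C) (p : ℕ) (hδ : 0 < δ) (hF : 0 ≤ F) :
    0 ≤ softBound C p δ F := by
  have h1 : 0 ≤ Real.log (2 + F) := Real.log_nonneg (by linarith)
  have h2 : 0 ≤ Real.log (2 + 1 / δ) := Real.log_nonneg (by
    have : 0 < 1 / δ := by positivity
    linarith)
  unfold softBound
  positivity

end NoisyCollab

/-! ### Assembling the two communication bounds -/

open NoisyCollab

theorem proposition17 :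
    ∃ (C : ℝ) (p : ℕ), 0 < C ∧
      ∀ (X : Type*) [MeasurableSpace X] (H : Set (X → Bool)) (d : ℕ),
      WellBehaved H → HasVCDim H d →
      -- the sample sizes requested by the algorithm exist
      (∀ ε δ η : ℝ, 0 < ε → 0 < δ → 0 ≤ η → η < 1 / 2 → ∃ m, SufficientSize H ε δ η m) ∧
      ∀ (k : ℕ) (D : Fin k → Measure X), (∀ i, IsProbabilityMeasure (D i)) →
      ∀ η : Fin k → ℝ, (∀ i, 0 ≤ η i ∧ η i < 1 / 2) →
      ∀ hstar ∈ H, ∀ ε δ c : ℝ, 0 < ε → 0 < δ → 0 < c →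
      ∀ A : List (X × Bool) → X → Bool, IsERM H A →
      ∀ (Ω : Type*) [MeasurableSpace Ω] (P : Measure Ω) [IsProbabilityMeasure P]
        (R : Ω → Draws X k), IsRandomDraws P D η hstar R →
      ∀ ω : Ω,
        (samplesCommunicated H c ε δ η A (R ω) : ℝ) ≤
            softBound C p δ (Real.log k * (d / (ε * (1 - 2 * maxNoise η) ^ 2))) ∧
        (bitsCommunicated H c ε δ η A (R ω) : ℝ) ≤
            softBound C p δ (k * Real.log (2 + d / (ε * (1 - 2 * maxNoise η) ^ 2))) := by
  refine ⟨1000000, 2, by norm_num, fun X _ H d hH hVC => ⟨fun ε δ η hε hδ h0 h1 =>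
    exists_sufficientSize hH hVC hε hδ h0 h1, ?_⟩⟩
  intro k _ _ η hη _ _ ε δ c hε hδ _ A _ Ω _ P _ R _ ω
  have hβ : 0 < 1 - 2 * maxNoise η := by
    have := maxNoise_lt_half fun i => (hη i).2
    linarith
  set β := 1 - 2 * maxNoise η with hβ_def
  set Q : ℝ := d / (ε * β ^ 2) with hQ_def
  have hQ : 0 ≤ Q := by positivity
  have hF0 : 0 ≤ Real.log k * Q := mul_nonneg (Real.log_natCast_nonneg k) hQ
  have hℓ0 : 0 ≤ Real.log (2 + Q) := Real.log_nonneg (by linarith)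
  have hG0 : 0 ≤ k * Real.log (2 + Q) := by positivity
  -- With at most one player there are no rounds and the blackboard stays empty.
  rcases lt_or_ge k 2 with hk | hk
  · have hclog : Nat.clog 2 k = 0 := Nat.clog_of_right_le_one (by omega) 2
    have hboard : (finalState H c ε δ η A (R ω)).board = [] := by
      rw [finalState, hclog, stateAfter]
    rw [samplesCommunicated, bitsCommunicated, hboard]
    simp only [List.countP_nil, Nat.cast_zero]
    exact ⟨softBound_nonneg (by norm_num) 2 hδ hF0, softBound_nonneg (by norm_num) 2 hδ hG0⟩
  set Λ := Real.log (2 + Real.log k * Q) with hΛ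
  set Δ := Real.log (2 + 1 / δ) with hΔ
  set Γ := Real.log (2 + k * Real.log (2 + Q)) with hΓ
  set B : ℝ := 24592 * Q * Λ * Δ with hB
  have hΛ1 : 1 / 2 < Λ := half_lt_log_two.trans_le (log_two_le_log_two_add hF0)
  have hΔ1 : 1 / 2 < Δ := half_lt_log_two.trans_le (log_two_le_log_two_add (by positivity))
  have hΓ1 : 1 / 2 < Γ := half_lt_log_two.trans_le (log_two_le_log_two_add hG0)
  have hB0 : 0 ≤ B := by positivity
  have hM : ∀ N : Finset (Fin k), N.Nonempty →
      sampleComplexity H (ε / 4) (roundConf k δ) (avgNoise η N) ≤ ⌊B⌋₊ := fun N hN =>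
    Nat.le_floor (sampleComplexity_round_le hH hVC hk hε hδ
      (avgNoise_nonneg (fun i => (hη i).1) N) hβ (by
        have := avgNoise_le_maxNoise η hN
        linarith))
  have hfloor : (⌊B⌋₊ : ℝ) ≤ B := Nat.floor_le hB0
  have hrounds := clog_two_le hk
  have hL0 : 0 ≤ Real.log k := Real.log_natCast_nonneg k
  constructor
  · have h1 : (samplesCommunicated H c ε δ η A (R ω) : ℝ) ≤ Nat.clog 2 k * ⌊B⌋₊ := by
      exact_mod_cast countP_isExample_stateAfter_le hM (Nat.clog 2 k)
    have h2 : (Nat.clog 2 k : ℝ) * ⌊B⌋₊ ≤ 4 * Real.log k * B := by gcongr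
    refine h1.trans (h2.trans ?_)
    rw [softBound, hB]
    have h3 : Λ ≤ 2 * Λ ^ 2 := by nlinarith
    calc 4 * Real.log k * (24592 * Q * Λ * Δ) = 98368 * (Real.log k * Q) * Λ * Δ := by ring
      _ ≤ 98368 * (Real.log k * Q) * (2 * Λ ^ 2) * Δ := by gcongr
      _ = 196736 * (Real.log k * Q) * Λ ^ 2 * Δ := by ring
      _ ≤ 1000000 * (Real.log k * Q) * Λ ^ 2 * Δ := by gcongr; norm_num
  · have h1 : (bitsCommunicated H c ε δ η A (R ω) : ℝ) ≤
        Nat.clog 2 k * (k * (2 * ⌊B⌋₊.size + 2)) := by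
      exact_mod_cast countP_isBit_stateAfter_le hM (Nat.clog 2 k)
    have h2 := size_bound hk hQ hΔ1 hfloor
    -- The number of rounds supplies one power of `Γ` and the code length the other, hence `p = 2`.
    have hlogk : Real.log k ≤ 2 * Γ := by
      have hk2 : (2 : ℝ) ≤ k := by exact_mod_cast hk
      have hℓ1 : 1 / 2 < Real.log (2 + Q) :=
        half_lt_log_two.trans_le (log_two_le_log_two_add hQ)
      have := log_pow_two_mul_le hG0 (y := (k : ℝ)) (by linarith) 1 (by nlinarith)
      norm_num at this
      linarith
    refine h1.trans ?_
    rw [softBound]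
    calc (Nat.clog 2 k : ℝ) * (k * (2 * ⌊B⌋₊.size + 2))
        ≤ 4 * (2 * Γ) * (k * (464 * Real.log (2 + Q) * Γ * Δ)) := by
          have : (Nat.clog 2 k : ℝ) ≤ 4 * (2 * Γ) := by linarith
          gcongr
      _ = 3712 * (k * Real.log (2 + Q)) * Γ ^ 2 * Δ := by ring
      _ ≤ 1000000 * (k * Real.log (2 + Q)) * Γ ^ 2 * Δ := by gcongr; norm_num
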